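/- Let $n\ge 1$ and $m\ge 0$ be integers, $n-1<\alpha\le n$, $r\in\mathbb R$, and let $f:\mathbb R\to\mathbb C$ (for instance real-valued) be of class $C^{m+n+1}$ with $f^{(k)}\in L^1(\mathbb R)$ for $0\le k\le m+n+1$. For $\beta>0$ the left and right Grünwald–Letnikov derivatives of order $\beta$ are $$ {}_{-\infty}D_x^{\beta}f(x)=\lim_{h\to0^+}h^{-\beta}\sum_{k\ge0}(-1)^k\binom{\beta}{k}f(x-kh),\qquad {}_xD_{\infty}^{\beta}f(x)=\lim_{h\to0^+}h^{-\beta}\sum_{k\ge0}(-1)^k\binom{\beta}{k}f(x+kh). $$ Let $(w_k)_{k\ge0}$ be a bounded sequence of real numbers, put $W(\zeta)=\sum_{k\ge0}w_k\zeta^k$, and for $h>0$ $$\Delta^{\alpha}_{\mp h,r}f(x)=h^{-\alpha}\sum_{k\ge0}w_k\,f(x\mp(k-r)h).$$ The sequence is said to approximate the left and right fractional derivatives of $f$ with order $p$ and shift $r$ if, for every $x\in\mathbb R$, these series converge for all $h>0$, both derivatives of order $\alpha$ exist at $x$, and, as $h\to0^+$, $$\Delta^{\alpha}_{-h,r}f(x)={}_{-\infty}D_x^{\alpha}f(x)+O(h^p),\qquad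 \Delta^{\alpha}_{+h,r}f(x)={}_xD_{\infty}^{\alpha}f(x)+O(h^p).$$ For $\operatorname{Re}z>0$ put $G_r(z)=z^{-\alpha}W(e^{-z})e^{rz}$ (principal branch of $z^\alpha$), and assume that $G_r$ has a Taylor expansion at $0$, i.e. that near $0$ it coincides on $\operatorname{Re}z>0$ with a function analytic in a neighbourhood of $0$. Let $1\le p\le m$. (1) If $f\not\equiv0$, then $(w_k)$ approximates the left and right fractional derivatives of $f$ with order $p$ and shift $r$ if and only if $$G_r(z)=1+O(z^p)\qquad(z\to0,\ \operatorname{Re}z>0).$$ Moreover, if this condition holds (and also when $f\equiv 0$), the approximation is of order $p$ with the $O(h^p)$ uniform in $x\in\mathbb R$. (2) If $G_r(z)=1+\sum_{l\ge p}a_l(r)z^l$ near $0$ in $\operatorname{Re}z>0$, then the left and right derivatives of $f$ of order $l+\alpha$ exist at every point for $0\le l\le m-1$ and, as $h\to0^+$, uniformly in $x\in\mathbb R$, $$\Delta^{\alpha}_{-h,r}f(x)={}_{-\infty}D_x^{\alpha}f(x)+\sum_{l=p}^{m-1}h^l a_l(r)\,{}_{-\infty}D_x^{l+\alpha}f(x)+O(h^m),$$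 $$\Delta^{\alpha}_{+h,r}f(x)={}_xD_{\infty}^{\alpha}f(x)+\sum_{l=p}^{m-1}h^l a_l(r)\,{}_xD_{\infty}^{l+\alpha}f(x)+O(h^m).$$ -/

import Mathlib

open Filter Topology MeasureTheory

noncomputable section

namespace Grunwald

/-- Left Grünwald type operator with weights `w` and shift `r`:
`h^(-α) * ∑ₖ wₖ f(x - (k - r) h)`. -/
def leftOp (α : ℝ) (w : ℕ → ℝ) (r h : ℝ) (f : ℝ → ℂ) (x : ℝ) : ℂ :=
  ((1 / h ^ α : ℝ) : ℂ) * ∑' k : ℕ, (w k : ℂ) * f (x - ((k : ℝ) - r) * h)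

/-- Right Grünwald type operator with weights `w` and shift `r`:
`h^(-α) * ∑ₖ wₖ f(x + (k - r) h)`. -/
def rightOp (α : ℝ) (w : ℕ → ℝ) (r h : ℝ) (f : ℝ → ℂ) (x : ℝ) : ℂ :=
  ((1 / h ^ α : ℝ) : ℂ) * ∑' k : ℕ, (w k : ℂ) * f (x + ((k : ℝ) - r) * h)

/-- For every step `h > 0` the series defining `leftOp` at `x` converges. -/
def LeftConverges (w : ℕ → ℝ) (r : ℝ) (f : ℝ → ℂ) (x : ℝ) : Prop :=
  ∀ h : ℝ, 0 < h → Summable fun k : ℕ => (w k : ℂ) * f (x - ((k : ℝ) - r) * h)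

/-- For every step `h > 0` the series defining `rightOp` at `x` converges. -/
def RightConverges (w : ℕ → ℝ) (r : ℝ) (f : ℝ → ℂ) (x : ℝ) : Prop :=
  ∀ h : ℝ, 0 < h → Summable fun k : ℕ => (w k : ℂ) * f (x + ((k : ℝ) - r) * h)

/-- The Grünwald-Letnikov weights `(-1)^k * binom(β, k)`. -/
def glWeight (β : ℝ) (k : ℕ) : ℝ := (-1) ^ k * Ring.choose β k

/-- `d` is the left Grünwald-Letnikov derivative of order `β` of `f` at `x`:
the limit of `h^(-β) * ∑ₖ (-1)^k binom(β, k) f(x - k h)` as `h → 0+`, all series converging. -/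
def HasLeftDeriv (β : ℝ) (f : ℝ → ℂ) (x : ℝ) (d : ℂ) : Prop :=
  LeftConverges (glWeight β) 0 f x ∧
    Tendsto (fun h : ℝ => leftOp β (glWeight β) 0 h f x) (𝓝[>] 0) (𝓝 d)

/-- `d` is the right Grünwald-Letnikov derivative of order `β` of `f` at `x`. -/
def HasRightDeriv (β : ℝ) (f : ℝ → ℂ) (x : ℝ) (d : ℂ) : Prop :=
  RightConverges (glWeight β) 0 f x ∧
    Tendsto (fun h : ℝ => rightOp β (glWeight β) 0 h f x) (𝓝[>] 0) (𝓝 d)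

/-- The sequence `w` approximates the left and right fractional derivatives of order `α` of `f`
with shift `r` and order `p`, at every point `x` (the constant in `O(h^p)` may depend on `x`). -/
def ApproximatesWithOrder (α : ℝ) (w : ℕ → ℝ) (r : ℝ) (p : ℕ) (f : ℝ → ℂ) : Prop :=
  ∀ x : ℝ,
    (LeftConverges w r f x ∧ ∃ d : ℂ, HasLeftDeriv α f x d ∧
      (fun h : ℝ => leftOp α w r h f x - d) =O[𝓝[>] 0] fun h : ℝ => h ^ p) ∧
    (RightConverges w r f x ∧ ∃ d : ℂ, HasRightDeriv α f x d ∧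
      (fun h : ℝ => rightOp α w r h f x - d) =O[𝓝[>] 0] fun h : ℝ => h ^ p)

/-- `E h x = O(h^q)` as `h → 0+`, uniformly in `x`. -/
def UniformBigO (E : ℝ → ℝ → ℂ) (q : ℕ) : Prop :=
  ∃ C : ℝ, ∃ h₀ : ℝ, 0 < h₀ ∧ ∀ h : ℝ, 0 < h → h < h₀ → ∀ x : ℝ, ‖E h x‖ ≤ C * h ^ q

/-- As `ApproximatesWithOrder`, with `O(h^p)` uniform in `x`. -/
def ApproximatesWithOrderUniformly (α : ℝ) (w : ℕ → ℝ) (r : ℝ) (p : ℕ) (f : ℝ → ℂ) : Prop :=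
  (∀ x : ℝ, LeftConverges w r f x ∧ RightConverges w r f x) ∧
  (∃ D : ℝ → ℂ, (∀ x : ℝ, HasLeftDeriv α f x (D x)) ∧
    UniformBigO (fun h x => leftOp α w r h f x - D x) p) ∧
  (∃ D : ℝ → ℂ, (∀ x : ℝ, HasRightDeriv α f x (D x)) ∧
    UniformBigO (fun h x => rightOp α w r h f x - D x) p)

/-- The generating function `W(z) = ∑ₖ wₖ z^k`. -/
def genFun (w : ℕ → ℝ) (z : ℂ) : ℂ := ∑' k : ℕ, (w k : ℂ) * z ^ k

/-- `G_r(z) = z^(-α) W(e^{-z}) e^{r z}`, used on `Re z > 0`, where `z^α` is the principal branch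
and, for bounded `w`, the series `W(e^{-z})` converges. -/
def symbolFun (α : ℝ) (w : ℕ → ℝ) (r : ℝ) (z : ℂ) : ℂ :=
  (1 / z ^ (α : ℂ)) * genFun w (Complex.exp (-z)) * Complex.exp ((r : ℂ) * z)

/-- The filter `z → 0`, `Re z > 0`. -/
def rightHalfNhds : Filter ℂ := 𝓝[{z : ℂ | 0 < z.re}] 0

end Grunwald

end

noncomputable section

open FourierTransform
open Complex (I)

namespace Grunwald

/-! On the Fourier side, with `freq ξ` = 2πiξ, the Grünwald operator of step h formally multiplies 𝓕
f by `freq ξ ^ α` · G_r(h · `freq ξ`), while D^(l+α) multiplies it by `freq ξ ^ (l + α)`. The Taylor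
polynomial of G_r at 0 therefore becomes the error expansion. Two obstacles remain: G_r is analytic
only near 0, and W(e^{-z}) need not converge on the imaginary axis, where the frequencies live.

A smooth cutoff χ(hξ) removes the first. Put N = m + n + 1. The high frequency part of f is h^N
times a multiplier of scale h, with quadratically decaying kernel, applied to the integrable
function f^(N). Its absolute values along a progression of step h sum to O(h^(N-1)), so bounded
weights contribute O(h^(N-1-α)), hence O(h^m) (`IsCutoff.exists_sum_norm_sub_lowPart_le`). On the
low frequency part, Abel summation pushes the argument into Re z > 0 and lets it return to the axis
(`tsum_mul_lowPart`). The Taylor remainder is controlled by `IsCutoff.exists_norm_remainder_le`, and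
`uniformBigO_leftOp_sub_sum` collects the three estimates.

The Grünwald-Letnikov weights are a special case: their symbol ((1 - e^{-z})/z)^β is 1 + O(z), so
the derivatives exist and equal the multiplier `fracD`. For the converse, comparing powers of h at a
fixed x gives (a_l - δ_{l0}) D^(l+α) f(x) = 0, and D^(l+α) f is not identically zero by Fourier
inversion (`fracD_ne_zero`). Right-sided statements follow by the reflection x ↦ -x. -/

/-! ### Kernel decay and sums along progressions. -/

theorem integrable_of_eq_inv_pow {M : ℝ → ℂ} {c : ℂ} {N : ℕ} {R : ℝ} (hM : Continuous M)
    (hN : 2 ≤ N) (h : ∀ ξ : ℝ, R < |ξ| → M ξ = c * ((ξ : ℂ) ^ N)⁻¹) : Integrable M := by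
  refine hM.locallyIntegrable.integrable_of_isBigO_cocompact (g := fun ξ : ℝ => (1 + ξ ^ 2)⁻¹) ?_
    (integrable_inv_one_add_sq.integrableAtFilter _)
  refine Asymptotics.IsBigO.of_bound (2 * ‖c‖) ?_
  have h1 : ∀ᶠ ξ : ℝ in cocompact ℝ, max R 1 < ‖ξ‖ :=
    (tendsto_norm_cocompact_atTop (E := ℝ)).eventually_gt_atTop _
  filter_upwards [h1] with ξ hξ
  have hR : R < |ξ| := (le_max_left _ _).trans_lt hξ
  have hx : 1 < |ξ| := (le_max_right _ _).trans_lt hξ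
  have hsq : (1 : ℝ) ≤ |ξ| ^ 2 := one_le_pow₀ hx.le
  have hpow : |ξ| ^ 2 ≤ |ξ| ^ N := pow_le_pow_right₀ hx.le hN
  rw [h ξ hR, norm_mul, norm_inv, norm_pow, Complex.norm_real, Real.norm_eq_abs, norm_inv,
    Real.norm_of_nonneg (by positivity), ← sq_abs ξ, mul_comm 2, mul_assoc]
  gcongr
  rw [← div_eq_mul_inv, inv_le_comm₀ (by positivity) (by positivity), inv_div]
  linarith

/-- Differentiation preserves the shape c / ξ ^ N at infinity, so the integrability criterion
applies again to M' and M''. The case c = 0 covers compactly supported multipliers. -/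
theorem deriv_eq_inv_pow {M : ℝ → ℂ} {c : ℂ} {N : ℕ} {R : ℝ} (hR : 0 ≤ R)
    (h : ∀ ξ : ℝ, R < |ξ| → M ξ = c * ((ξ : ℂ) ^ N)⁻¹) (ξ : ℝ) (hξ : R < |ξ|) :
    deriv M ξ = -(c * N) * ((ξ : ℂ) ^ (N + 1))⁻¹ := by
  have hev : M =ᶠ[𝓝 ξ] fun ξ : ℝ => c * ((ξ : ℂ) ^ N)⁻¹ := by
    filter_upwards [continuous_abs.continuousAt.eventually (lt_mem_nhds hξ)] with η hη
    exact h η hη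
  have hne : (ξ : ℂ) ≠ 0 := by
    have : ξ ≠ 0 := abs_pos.mp (hR.trans_lt hξ)
    exact_mod_cast this
  rw [hev.deriv_eq]
  have h1 : HasDerivAt (fun z : ℂ => z ^ N) (N * (ξ : ℂ) ^ (N - 1)) (ξ : ℂ) := hasDerivAt_pow N _
  have h2 := ((h1.inv (pow_ne_zero N hne)).comp_ofReal).const_mul c
  refine (h2.congr_of_eventuallyEq ?_).deriv.trans ?_
  · exact Eventually.of_forall fun η => by simp
  rcases N with _ | N
  · simp
  · have : (ξ : ℂ) ^ (N + 1) ≠ 0 := pow_ne_zero _ hne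
    simp only [Nat.add_sub_cancel]
    field_simp
    ring

/-- The Fourier transform of a `C²` function equal to `c / ξ ^ N`, `N ≥ 2`, for large `|ξ|`
decays quadratically. -/
theorem exists_norm_fourier_le {M : ℝ → ℂ} {c : ℂ} {N : ℕ} {R : ℝ} (hM : ContDiff ℝ 2 M)
    (hN : 2 ≤ N) (hR : 0 ≤ R) (h : ∀ ξ : ℝ, R < |ξ| → M ξ = c * ((ξ : ℂ) ^ N)⁻¹) :
    ∃ C : ℝ, 0 ≤ C ∧ ∀ s : ℝ, ‖𝓕 M s‖ ≤ C * (1 + s ^ 2)⁻¹ := by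
  have h1 := deriv_eq_inv_pow hR h
  have h2 := deriv_eq_inv_pow hR h1
  have hint : ∀ k : ℕ, (k : ℕ∞) ≤ 2 → Integrable (iteratedDeriv k M) := by
    intro k hk
    have hk' : k ≤ 2 := by exact_mod_cast hk
    have hc : Continuous (iteratedDeriv k M) :=
      hM.continuous_iteratedDeriv k (by exact_mod_cast hk')
    interval_cases k
    · simpa using integrable_of_eq_inv_pow (by simpa using hc) hN h
    · rw [iteratedDeriv_one] at hc ⊢
      exact integrable_of_eq_inv_pow hc (by omega) h1
    · rw [iteratedDeriv_succ, iteratedDeriv_one] at hc ⊢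
      exact integrable_of_eq_inv_pow hc (by omega) h2
  have hF := Real.fourier_iteratedDeriv (N := 2) (n := 2) hM hint le_rfl
  have hb : ∀ (g : ℝ → ℂ) (s : ℝ), ‖𝓕 g s‖ ≤ ∫ v, ‖g v‖ := fun g s =>
    VectorFourier.norm_fourierIntegral_le_integral_norm _ _ _ _ _
  -- ‖M‖₁ bounds 𝓕 M and ‖M''‖₁ bounds (2πs)² 𝓕 M; since (2π)² ≥ 1, their sum bounds (1 + s²) 𝓕 M.
  refine ⟨(∫ v, ‖M v‖) + ∫ v, ‖iteratedDeriv 2 M v‖, by positivity, fun s => ?_⟩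
  rw [← div_eq_mul_inv, le_div_iff₀ (by positivity), mul_add, mul_one]
  refine add_le_add (hb M s) ((le_trans ?_ (hb _ s)))
  rw [hF]
  simp only [smul_eq_mul, norm_mul, norm_pow, Complex.norm_I, Complex.norm_real,
    Complex.norm_ofNat, Real.norm_eq_abs, mul_pow, sq_abs]
  have hpi : 1 ≤ (2 : ℝ) ^ 2 * Real.pi ^ 2 := by nlinarith [Real.pi_gt_three]
  rw [mul_comm]
  refine mul_le_mul_of_nonneg_right ?_ (norm_nonneg _)
  nlinarith [sq_nonneg s]

/-- Replacing s by its floor turns the sum into part of a fixed convergent series over ℤ, at the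
price of a constant; this makes the bound uniform in s. -/
theorem exists_sum_inv_one_add_sq_le :
    ∃ K : ℝ, 0 ≤ K ∧ ∀ (s : ℝ) (S : Finset ℕ), ∑ k ∈ S, (1 + (s + k) ^ 2)⁻¹ ≤ K := by
  have hsum : Summable fun a : ℤ => (1 + (a : ℝ) ^ 2)⁻¹ := by
    have h1 : Summable fun a : ℤ => 1 / (a : ℝ) ^ 2 :=
      Real.summable_one_div_int_pow.mpr one_lt_two
    have h2 : Summable fun a : ℤ => if a = 0 then (1 : ℝ) else 0 := (hasSum_ite_eq 0 1).summable
    refine Summable.of_nonneg_of_le (fun a => by positivity) (fun a => ?_) (h1.add h2)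
    rcases eq_or_ne a 0 with rfl | ha
    · simp
    · have : (0 : ℝ) < (a : ℝ) ^ 2 := by positivity
      simp only [ha, if_false, add_zero, ← one_div]
      gcongr
      linarith
  refine ⟨3 * ∑' a : ℤ, (1 + (a : ℝ) ^ 2)⁻¹, by positivity, fun s S => ?_⟩
  have hinj : Set.InjOn (fun k : ℕ => ⌊s⌋ + (k : ℤ)) S := by
    intro a _ b _ hab
    simpa using hab
  calc ∑ k ∈ S, (1 + (s + k) ^ 2)⁻¹
      ≤ ∑ k ∈ S, 3 * (1 + (((⌊s⌋ + (k : ℤ) : ℤ) : ℝ)) ^ 2)⁻¹ := by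
        refine Finset.sum_le_sum fun k _ => ?_
        have h0 := Int.floor_le s
        have h1 := Int.lt_floor_add_one s
        -- With u = s + k and d = s - ⌊s⌋ in [0, 1), (u - d)² ≤ 2u² + 2d² gives 1 + (u - d)² ≤ 3(1 +
        -- u²).
        rw [← div_eq_mul_inv, ← one_div, div_le_div_iff₀ (by positivity) (by positivity)]
        push_cast
        nlinarith [sq_nonneg (s + k + (s - ⌊s⌋)), sq_nonneg (s - ⌊s⌋)]
    _ = 3 * ∑ a ∈ S.image (fun k : ℕ => ⌊s⌋ + (k : ℤ)), (1 + (a : ℝ) ^ 2)⁻¹ := by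
        rw [Finset.sum_image hinj, Finset.mul_sum]
    _ ≤ _ := by
        gcongr
        exact hsum.sum_le_tsum _ (fun a _ => by positivity)

/-! ### Fourier synthesis and multipliers. -/

/-- The character `ξ ↦ exp (2 π i x ξ)`. -/
def wave (x ξ : ℝ) : ℂ := Complex.exp (((2 * Real.pi * x * ξ : ℝ) : ℂ) * I)

theorem norm_wave (x ξ : ℝ) : ‖wave x ξ‖ = 1 := Complex.norm_exp_ofReal_mul_I _

@[fun_prop]
theorem continuous_wave (x : ℝ) : Continuous (wave x) := by
  unfold wave
  fun_prop

theorem wave_add (x y ξ : ℝ) : wave (x + y) ξ = wave x ξ * wave y ξ := by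
  rw [wave, wave, wave, ← Complex.exp_add]
  congr 1
  push_cast
  ring

/-- The inverse Fourier integral `∫ A ξ exp (2 π i x ξ) dξ`. -/
def synth (A : ℝ → ℂ) (x : ℝ) : ℂ := ∫ ξ : ℝ, A ξ * wave x ξ

theorem synth_eq (A : ℝ → ℂ) : synth A = 𝓕⁻ A := by
  ext x
  rw [Real.fourierInv_eq']
  refine integral_congr_ae (Eventually.of_forall fun ξ => ?_)
  simp only [wave, smul_eq_mul]
  rw [mul_comm]
  congr 3
  simp [mul_assoc, mul_comm, mul_left_comm]

theorem norm_synth_le (A : ℝ → ℂ) (x : ℝ) : ‖synth A x‖ ≤ ∫ ξ, ‖A ξ‖ := by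
  refine (norm_integral_le_integral_norm _).trans_eq ?_
  simp [norm_wave]

theorem integrable_mul_wave {A : ℝ → ℂ} (hA : Integrable A) (x : ℝ) :
    Integrable fun ξ => A ξ * wave x ξ :=
  hA.mul_bdd (c := 1) (continuous_wave x).aestronglyMeasurable
    (Eventually.of_forall fun ξ => (norm_wave x ξ).le)

/-- The multiplication formula moves the Fourier transform from g to M(h ·), so the multiplier
becomes an integral against the kernel 𝓕 M rescaled to width h. -/
theorem synth_mul_fourier {M g : ℝ → ℂ} (hM : Integrable M) (hg : Integrable g) {h : ℝ}
    (hh : 0 < h) (x : ℝ) :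
    synth (fun ξ => M (h * ξ) * 𝓕 g ξ) x = ∫ y, g y * ((h⁻¹ : ℝ) * 𝓕 M ((y - x) / h)) := by
  have hMh : Integrable fun ξ => M (h * ξ) := hM.comp_mul_left' hh.ne'
  have key := VectorFourier.integral_fourierIntegral_smul_eq_flip (μ := volume) (ν := volume)
    (L := innerₗ ℝ) Real.continuous_fourierChar continuous_inner hg (integrable_mul_wave hMh x)
  have h1 : synth (fun ξ => M (h * ξ) * 𝓕 g ξ) x
      = ∫ ξ, 𝓕 g ξ • (M (h * ξ) * wave x ξ) := by
    refine integral_congr_ae (Eventually.of_forall fun ξ => ?_)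
    simp only [smul_eq_mul]
    ring
  rw [h1]
  refine key.trans (integral_congr_ae (Eventually.of_forall fun y => ?_))
  simp only [smul_eq_mul]
  congr 1
  have h2 : VectorFourier.fourierIntegral Real.fourierChar volume (innerₗ ℝ).flip
      (fun ξ => M (h * ξ) * wave x ξ) y = 𝓕 (fun ξ => M (h * ξ) * wave x ξ) y := by
    rw [flip_innerₗ]
    rfl
  rw [h2, Real.fourier_real_eq_integral_exp_smul, Real.fourier_real_eq_integral_exp_smul]
  have h3 := Measure.integral_comp_mul_left
    (fun η : ℝ => Complex.exp (((-2 * Real.pi * η * ((y - x) / h) : ℝ) : ℂ) * I) • M η) h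
  rw [abs_of_pos (inv_pos.mpr hh), Complex.real_smul] at h3
  rw [← h3]
  refine integral_congr_ae (Eventually.of_forall fun ξ => ?_)
  simp only [smul_eq_mul, wave]
  rw [mul_comm (M _), ← mul_assoc, ← Complex.exp_add]
  congr 2
  have : ((h : ℝ) : ℂ) ≠ 0 := by exact_mod_cast hh.ne'
  push_cast
  field_simp
  ring

/-- A multiplier whose kernel decays quadratically maps integrable functions to functions that
are summable along arithmetic progressions. -/
theorem exists_sum_norm_synth_le {M : ℝ → ℂ} (hM : Integrable M) {C : ℝ} (hC : 0 ≤ C)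
    (hMC : ∀ s : ℝ, ‖𝓕 M s‖ ≤ C * (1 + s ^ 2)⁻¹) (hMm : Continuous (𝓕 M)) :
    ∃ K : ℝ, 0 ≤ K ∧ ∀ (g : ℝ → ℂ), Integrable g → ∀ (h : ℝ), 0 < h → ∀ (x r : ℝ) (S : Finset ℕ),
      ∑ k ∈ S, ‖synth (fun ξ => M (h * ξ) * 𝓕 g ξ) (x - ((k : ℝ) - r) * h)‖
        ≤ h⁻¹ * K * ∫ y, ‖g y‖ := by
  obtain ⟨K, hK, hKs⟩ := exists_sum_inv_one_add_sq_le
  refine ⟨C * K, by positivity, fun g hg h hh x r S => ?_⟩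
  have hbdd : ∀ s : ℝ, ‖𝓕 M s‖ ≤ C := fun s => (hMC s).trans <| by
    refine mul_le_of_le_one_right hC (inv_le_one_of_one_le₀ ?_)
    nlinarith [sq_nonneg s]
  have hi : ∀ k : ℕ, Integrable fun y =>
      ‖g y‖ * (h⁻¹ * ‖𝓕 M ((y - (x - ((k : ℝ) - r) * h)) / h)‖) := by
    intro k
    refine hg.norm.mul_bdd (c := h⁻¹ * C) ?_ (Eventually.of_forall fun y => ?_)
    · exact Continuous.aestronglyMeasurable (by fun_prop)
    · rw [Real.norm_of_nonneg (by positivity)]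
      gcongr
      exact hbdd _
  calc ∑ k ∈ S, ‖synth (fun ξ => M (h * ξ) * 𝓕 g ξ) (x - ((k : ℝ) - r) * h)‖
      ≤ ∑ k ∈ S, ∫ y, ‖g y‖ * (h⁻¹ * ‖𝓕 M ((y - (x - ((k : ℝ) - r) * h)) / h)‖) := by
        refine Finset.sum_le_sum fun k _ => ?_
        rw [synth_mul_fourier hM hg hh]
        refine (norm_integral_le_integral_norm _).trans_eq ?_
        refine integral_congr_ae (Eventually.of_forall fun y => ?_)
        simp only [norm_mul, Complex.norm_real, Real.norm_of_nonneg (inv_pos.mpr hh).le]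
    _ = ∫ y, ∑ k ∈ S, ‖g y‖ * (h⁻¹ * ‖𝓕 M ((y - (x - ((k : ℝ) - r) * h)) / h)‖) :=
        (integral_finsetSum _ fun k _ => hi k).symm
    _ ≤ ∫ y, ‖g y‖ * (h⁻¹ * (C * K)) := by
        refine integral_mono (integrable_finsetSum _ fun k _ => hi k) (hg.norm.mul_const _)
          fun y => ?_
        simp only [← Finset.mul_sum]
        gcongr
        refine (Finset.sum_le_sum fun k _ => hMC _).trans ?_
        rw [← Finset.mul_sum]
        gcongr
        refine le_of_eq_of_le (Finset.sum_congr rfl fun k _ => ?_) (hKs ((y - x) / h - r) S)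
        congr 3
        field_simp
        ring
    _ = h⁻¹ * (C * K) * ∫ y, ‖g y‖ := by rw [integral_mul_const]; ring

/-! ### The symbol of the derivative and decay of 𝓕 f. -/

/-- The symbol `2 π i ξ` of the derivative. -/
def freq (ξ : ℝ) : ℂ := 2 * Real.pi * I * ξ

@[fun_prop]
theorem continuous_freq : Continuous freq := by
  unfold freq
  fun_prop

theorem freq_mul (h ξ : ℝ) : freq (h * ξ) = h * freq ξ := by
  simp only [freq]
  push_cast
  ring

theorem norm_freq (ξ : ℝ) : ‖freq ξ‖ = 2 * Real.pi * |ξ| := by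
  simp [freq, abs_of_pos Real.pi_pos]

theorem abs_le_norm_freq (ξ : ℝ) : |ξ| ≤ ‖freq ξ‖ := by
  rw [norm_freq]
  nlinarith [Real.pi_gt_three, abs_nonneg ξ]

theorem freq_re (ξ : ℝ) : (freq ξ).re = 0 := by simp [freq]

theorem freq_eq_zero {ξ : ℝ} : freq ξ = 0 ↔ ξ = 0 := by
  simp [freq, Real.pi_ne_zero]

theorem wave_neg_mul (t h ξ : ℝ) : wave (-(t * h)) ξ = Complex.exp (-(t * freq (h * ξ))) := by
  simp only [wave, freq]
  congr 1
  push_cast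
  ring

/-- The imaginary axis meets the branch cut only at 0, where continuity comes from β > 0. This is
what permits boundary limits from Re z > 0. -/
theorem continuousAt_cpow_freq {β : ℝ} (hβ : 0 < β) (ξ : ℝ) :
    ContinuousAt (fun z : ℂ => z ^ (β : ℂ)) (freq ξ) :=
   Complex.continuousAt_cpow_const_of_re_pos (Or.inl (freq_re ξ).ge) (by simpa using hβ)

@[fun_prop]
theorem measurable_freq : Measurable freq := continuous_freq.measurable

theorem measurable_cpow_freq (β : ℝ) : Measurable fun ξ => freq ξ ^ (β : ℂ) :=
  measurable_freq.pow_const _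

theorem norm_fourier_le (g : ℝ → ℂ) (ξ : ℝ) : ‖𝓕 g ξ‖ ≤ ∫ v, ‖g v‖ :=
  VectorFourier.norm_fourierIntegral_le_integral_norm _ _ _ _ _

theorem continuous_fourier {g : ℝ → ℂ} (hg : Integrable g) : Continuous (𝓕 g) :=
  VectorFourier.fourierIntegral_continuous Real.continuous_fourierChar
    (by exact continuous_inner) hg

/-- `f` belongs to `C^N` and its derivatives up to order `N` are integrable. -/
def SobolevL1 (N : ℕ) (f : ℝ → ℂ) : Prop :=
  ContDiff ℝ (N : WithTop ℕ∞) f ∧ ∀ k : ℕ, k ≤ N → Integrable (iteratedDeriv k f)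

theorem SobolevL1.integrable {N : ℕ} {f : ℝ → ℂ} (hf : SobolevL1 N f) : Integrable f := by
  simpa using hf.2 0 (Nat.zero_le _)

theorem SobolevL1.fourier_iteratedDeriv {N : ℕ} {f : ℝ → ℂ} (hf : SobolevL1 N f) {k : ℕ}
    (hk : k ≤ N) (ξ : ℝ) : 𝓕 (iteratedDeriv k f) ξ = freq ξ ^ k * 𝓕 f ξ := by
  have := Real.fourier_iteratedDeriv (N := (N : ℕ∞)) (n := k) (by exact_mod_cast hf.1)
    (fun j hj => hf.2 j (by exact_mod_cast hj)) (by exact_mod_cast hk)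
  rw [this]
  rfl

theorem SobolevL1.exists_norm_fourier_le {N : ℕ} {f : ℝ → ℂ} (hf : SobolevL1 N f) :
    ∃ A : ℝ, 0 ≤ A ∧ ∀ ξ : ℝ, ‖𝓕 f ξ‖ ≤ A * (1 + ‖freq ξ‖) ^ (-(N : ℝ)) := by
  -- The factor is the convexity constant in (1 + t)^N ≤ 2^(N-1) (1 + t^N).
  refine ⟨2 ^ (N - 1) * ((∫ v, ‖f v‖) + ∫ v, ‖iteratedDeriv N f v‖), by positivity, fun ξ => ?_⟩
  have hpos : (0 : ℝ) < 1 + ‖freq ξ‖ := by positivity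
  rw [Real.rpow_neg hpos.le, Real.rpow_natCast, ← div_eq_mul_inv, le_div_iff₀ (by positivity)]
  have h1 := add_pow_le (zero_le_one' ℝ) (norm_nonneg (freq ξ)) N
  have h2 := norm_fourier_le (iteratedDeriv N f) ξ
  rw [hf.fourier_iteratedDeriv le_rfl, norm_mul, norm_pow] at h2
  calc ‖𝓕 f ξ‖ * (1 + ‖freq ξ‖) ^ N
      ≤ ‖𝓕 f ξ‖ * (2 ^ (N - 1) * (1 ^ N + ‖freq ξ‖ ^ N)) := by gcongr
    _ = 2 ^ (N - 1) * (‖𝓕 f ξ‖ + ‖freq ξ‖ ^ N * ‖𝓕 f ξ‖) := by ring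
    _ ≤ _ := by
        gcongr
        exact norm_fourier_le f ξ

theorem SobolevL1.integrable_cpow_mul_fourier {N : ℕ} {f : ℝ → ℂ} (hf : SobolevL1 N f) {β : ℝ}
    (hβ : 0 ≤ β) (hβN : β + 1 < N) : Integrable fun ξ => freq ξ ^ (β : ℂ) * 𝓕 f ξ := by
  obtain ⟨A, hA, hAF⟩ := hf.exists_norm_fourier_le
  have hr : (Module.finrank ℝ ℝ : ℝ) < N - β := by
    simp only [Module.finrank_self, Nat.cast_one]
    linarith
  refine ((integrable_one_add_norm (μ := (volume : Measure ℝ)) hr).const_mul A).mono' ?_ ?_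
  · exact ((measurable_cpow_freq β).mul
      (continuous_fourier hf.integrable).measurable).aestronglyMeasurable
  · refine Eventually.of_forall fun ξ => ?_
    rw [norm_mul, Complex.norm_cpow_real]
    have hpos : (0 : ℝ) < 1 + ‖freq ξ‖ := by positivity
    calc ‖freq ξ‖ ^ β * ‖𝓕 f ξ‖
        ≤ (1 + ‖freq ξ‖) ^ β * (A * (1 + ‖freq ξ‖) ^ (-(N : ℝ))) := by
          gcongr
          · linarith
          · exact hAF ξ
      _ = A * (1 + ‖freq ξ‖) ^ (-((N : ℝ) - β)) := by
          rw [mul_left_comm, ← Real.rpow_add hpos]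
          congr 2
          ring
      _ ≤ A * (1 + ‖ξ‖) ^ (-((N : ℝ) - β)) := by
          gcongr A * ?_
          refine Real.rpow_le_rpow_of_nonpos (by positivity) ?_ (by linarith)
          gcongr
          exact abs_le_norm_freq ξ

theorem SobolevL1.integrable_fourier {N : ℕ} {f : ℝ → ℂ} (hf : SobolevL1 N f) (hN : 2 ≤ N) :
    Integrable (𝓕 f) := by
  have hN' : (2 : ℝ) ≤ N := by exact_mod_cast hN
  simpa using hf.integrable_cpow_mul_fourier (β := 0) le_rfl (by linarith)

theorem SobolevL1.synth_fourier {N : ℕ} {f : ℝ → ℂ} (hf : SobolevL1 N f) (hN : 2 ≤ N) :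
    synth (𝓕 f) = f := by
  rw [synth_eq]
  exact hf.1.continuous.fourierInv_fourier_eq hf.integrable (hf.integrable_fourier hN)

/-! ### Frequency cutoff: splitting f at scale h. -/

/-- A smooth function with values in `[0, 1]`, equal to `1` near `0` and to `0` outside of the
region `|2 π ξ| < δ`. -/
structure IsCutoff (δ : ℝ) (χ : ℝ → ℝ) : Prop where
  contDiff : ContDiff ℝ 2 χ
  nonneg : ∀ ξ, 0 ≤ χ ξ
  le_one : ∀ ξ, χ ξ ≤ 1
  eventually_eq_one : ∀ᶠ ξ in 𝓝 (0 : ℝ), χ ξ = 1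
  eq_zero : ∀ ξ, δ ≤ ‖freq ξ‖ → χ ξ = 0

theorem exists_isCutoff {δ : ℝ} (hδ : 0 < δ) : ∃ χ, IsCutoff δ χ := by
  have hpi := Real.pi_pos
  -- The radii carry a factor 1/(2π) because ‖`freq ξ`‖ = 2π|ξ|.
  let b : ContDiffBump (0 : ℝ) :=
    ⟨δ / (4 * Real.pi), δ / (2 * Real.pi), by positivity, by
      gcongr
      norm_num⟩
  refine ⟨b, b.contDiff, fun ξ => b.nonneg, fun ξ => b.le_one, b.eventuallyEq_one, fun ξ hξ => ?_⟩
  refine b.zero_of_le_dist ?_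
  rw [dist_zero_right, Real.norm_eq_abs, div_le_iff₀ (by positivity)]
  rw [norm_freq] at hξ
  linarith

theorem IsCutoff.eq_zero_of_lt_abs {δ : ℝ} {χ : ℝ → ℝ} (hχ : IsCutoff δ χ) {ξ : ℝ}
    (hξ : δ < |ξ|) : χ ξ = 0 :=
  hχ.eq_zero ξ (hξ.le.trans (abs_le_norm_freq ξ))

theorem IsCutoff.contDiff_ofReal {δ : ℝ} {χ : ℝ → ℝ} (hχ : IsCutoff δ χ) :
    ContDiff ℝ 2 fun ξ => (χ ξ : ℂ) := Complex.ofRealCLM.contDiff.comp hχ.contDiff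

/-- The high frequency multiplier `(1 - χ ξ) / (2 π i ξ) ^ N`. -/
def tailMult (χ : ℝ → ℝ) (N : ℕ) (ξ : ℝ) : ℂ := (1 - χ ξ) * (freq ξ ^ N)⁻¹

theorem IsCutoff.contDiff_tailMult {δ : ℝ} {χ : ℝ → ℝ} (hχ : IsCutoff δ χ) (N : ℕ) :
    ContDiff ℝ 2 (tailMult χ N) := by
  rw [contDiff_iff_contDiffAt]
  intro ξ
  rcases eq_or_ne ξ 0 with rfl | hξ
  · refine (contDiffAt_const (c := (0 : ℂ))).congr_of_eventuallyEq ?_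
    filter_upwards [hχ.eventually_eq_one] with η hη
    simp [tailMult, hη]
  · refine (contDiff_const.sub hχ.contDiff_ofReal).contDiffAt.mul (ContDiffAt.inv ?_ ?_)
    · refine ContDiffAt.pow ?_ N
      exact contDiffAt_const.mul Complex.ofRealCLM.contDiff.contDiffAt
    · exact pow_ne_zero _ (mt freq_eq_zero.mp hξ)

theorem IsCutoff.tailMult_eq {δ : ℝ} {χ : ℝ → ℝ} (hχ : IsCutoff δ χ) (N : ℕ) (ξ : ℝ)
    (hξ : δ < |ξ|) : tailMult χ N ξ = ((2 * Real.pi * I) ^ N)⁻¹ * ((ξ : ℂ) ^ N)⁻¹ := by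
  rw [tailMult, hχ.eq_zero_of_lt_abs hξ, freq, mul_pow, mul_inv]
  simp

/-- The value of the inverse at ξ = 0 is harmless, because 1 - χ vanishes there. -/
theorem IsCutoff.tailMult_freq {δ : ℝ} {χ : ℝ → ℝ} (hχ : IsCutoff δ χ) (N : ℕ) (ξ : ℝ) :
    freq ξ ^ N * tailMult χ N ξ = 1 - χ ξ := by
  rcases eq_or_ne ξ 0 with rfl | hξ
  · simp [tailMult, hχ.eventually_eq_one.self_of_nhds]
  · rw [tailMult, mul_left_comm, mul_inv_cancel₀ (pow_ne_zero _ (mt freq_eq_zero.mp hξ)), mul_one]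

theorem exists_sum_norm_synth_le_of_contDiff {M : ℝ → ℂ} {c : ℂ} {N : ℕ} {R : ℝ}
    (hM : ContDiff ℝ 2 M) (hN : 2 ≤ N) (hR : 0 ≤ R)
    (h : ∀ ξ : ℝ, R < |ξ| → M ξ = c * ((ξ : ℂ) ^ N)⁻¹) :
    ∃ K : ℝ, 0 ≤ K ∧ ∀ (g : ℝ → ℂ), Integrable g → ∀ (h : ℝ), 0 < h → ∀ (x r : ℝ) (S : Finset ℕ),
      ∑ k ∈ S, ‖synth (fun ξ => M (h * ξ) * 𝓕 g ξ) (x - ((k : ℝ) - r) * h)‖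
        ≤ h⁻¹ * K * ∫ y, ‖g y‖ := by
  obtain ⟨C, hC, hMC⟩ := exists_norm_fourier_le hM hN hR h
  have hi := integrable_of_eq_inv_pow hM.continuous hN h
  exact exists_sum_norm_synth_le hi hC hMC (continuous_fourier hi)

/-- The low frequency part of `f` at scale `h`. -/
def lowPart (χ : ℝ → ℝ) (h : ℝ) (f : ℝ → ℂ) (x : ℝ) : ℂ :=
  synth (fun ξ => (χ (h * ξ) : ℂ) * 𝓕 f ξ) x

theorem IsCutoff.summable_lowPart {δ : ℝ} {χ : ℝ → ℝ} (hδ : 0 < δ) (hχ : IsCutoff δ χ)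
    {f : ℝ → ℂ} (hf : Integrable f) {h : ℝ} (hh : 0 < h) (x r : ℝ) :
    Summable fun k : ℕ => ‖lowPart χ h f (x - ((k : ℝ) - r) * h)‖ := by
  obtain ⟨K, _, hK⟩ := exists_sum_norm_synth_le_of_contDiff (c := 0) hχ.contDiff_ofReal le_rfl
    hδ.le (fun ξ hξ => by simp [hχ.eq_zero_of_lt_abs hξ])
  exact summable_of_sum_le (fun k => norm_nonneg _) (fun S => hK f hf h hh x r S)

/-- Since 1 - χ(hξ) = (h · `freq ξ`)^N `tailMult χ N (h * ξ)`, the high frequency part is h^N times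
a multiplier of scale h acting on f^(N). Summing the kernel along a progression of step h costs only
one factor h⁻¹. -/
theorem IsCutoff.exists_sum_norm_sub_lowPart_le {δ : ℝ} {χ : ℝ → ℝ} (hδ : 0 < δ)
    (hχ : IsCutoff δ χ) {N : ℕ} (hN : 2 ≤ N) {f : ℝ → ℂ} (hf : SobolevL1 N f) :
    ∃ K : ℝ, 0 ≤ K ∧ ∀ (h : ℝ), 0 < h → ∀ (x r : ℝ) (S : Finset ℕ),
      ∑ k ∈ S, ‖f (x - ((k : ℝ) - r) * h) - lowPart χ h f (x - ((k : ℝ) - r) * h)‖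
        ≤ h ^ N * h⁻¹ * K := by
  obtain ⟨K, hK0, hK⟩ := exists_sum_norm_synth_le_of_contDiff (hχ.contDiff_tailMult N) hN hδ.le
    (hχ.tailMult_eq N)
  refine ⟨K * ∫ y, ‖iteratedDeriv N f y‖, by positivity, fun h hh x r S => ?_⟩
  have key : ∀ y, f y - lowPart χ h f y
      = (h : ℂ) ^ N * synth (fun ξ => tailMult χ N (h * ξ) * 𝓕 (iteratedDeriv N f) ξ) y := by
    intro y
    have hint := hf.integrable_fourier hN
    have hlow : Integrable fun ξ => (χ (h * ξ) : ℂ) * 𝓕 f ξ := by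
      refine hint.bdd_mul (c := 1) ?_ (Eventually.of_forall fun ξ => ?_)
      · exact (hχ.contDiff_ofReal.continuous.comp
          (continuous_const_mul h)).aestronglyMeasurable
      · rw [Complex.norm_real, Real.norm_of_nonneg (hχ.nonneg _)]
        exact hχ.le_one _
    have hfy : f y = synth (𝓕 f) y := (congrFun (hf.synth_fourier hN) y).symm
    rw [hfy, lowPart, synth, synth, synth,
      ← integral_sub (integrable_mul_wave hint y) (integrable_mul_wave hlow y),
      ← integral_const_mul]
    refine integral_congr_ae (Eventually.of_forall fun ξ => ?_)
    have h1 := hχ.tailMult_freq N (h * ξ)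
    rw [freq_mul, mul_pow] at h1
    simp only [hf.fourier_iteratedDeriv le_rfl]
    linear_combination (-(𝓕 f ξ * wave y ξ)) * h1
  calc _ = h ^ N * ∑ k ∈ S, ‖synth (fun ξ => tailMult χ N (h * ξ) * 𝓕 (iteratedDeriv N f) ξ)
          (x - ((k : ℝ) - r) * h)‖ := by
        rw [Finset.mul_sum]
        refine Finset.sum_congr rfl fun k _ => ?_
        rw [key, norm_mul, norm_pow, Complex.norm_real, Real.norm_of_nonneg hh.le]
    _ ≤ h ^ N * (h⁻¹ * K * ∫ y, ‖iteratedDeriv N f y‖) := by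
        gcongr
        exact hK _ (hf.2 N le_rfl) h hh x r S
    _ = _ := by ring

/-- Both the low frequency part and the rest are summable along the progression, by kernel decay; no
pointwise decay of f itself is needed. -/
theorem SobolevL1.summable_norm {N : ℕ} (hN : 2 ≤ N) {f : ℝ → ℂ} (hf : SobolevL1 N f) {h : ℝ}
    (hh : 0 < h) (x r : ℝ) : Summable fun k : ℕ => ‖f (x - ((k : ℝ) - r) * h)‖ := by
  obtain ⟨χ, hχ⟩ := exists_isCutoff one_pos
  obtain ⟨K, _, hK⟩ := hχ.exists_sum_norm_sub_lowPart_le one_pos hN hf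
  refine Summable.of_nonneg_of_le (fun k => norm_nonneg _) (fun k => ?_)
    ((hχ.summable_lowPart one_pos hf.integrable hh x r).add
      (summable_of_sum_le (fun k => norm_nonneg _) (fun S => hK h hh x r S)))
  simpa using norm_add_le (lowPart χ h f (x - ((k : ℝ) - r) * h))
    (f (x - ((k : ℝ) - r) * h) - lowPart χ h f (x - ((k : ℝ) - r) * h))

theorem summable_mul_of_bounded {w : ℕ → ℝ} {B : ℝ} (hw : ∀ k, |w k| ≤ B) {u : ℕ → ℂ}
    (hu : Summable fun k => ‖u k‖) : Summable fun k => (w k : ℂ) * u k := by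
  refine Summable.of_norm_bounded (hu.mul_left B) fun k => ?_
  rw [norm_mul, Complex.norm_real]
  exact mul_le_mul_of_nonneg_right (hw k) (norm_nonneg _)

theorem leftConverges_of_bounded {w : ℕ → ℝ} {B : ℝ} (hw : ∀ k, |w k| ≤ B) {N : ℕ} (hN : 2 ≤ N)
    {f : ℝ → ℂ} (hf : SobolevL1 N f) (r x : ℝ) : LeftConverges w r f x :=
  fun _ hh => summable_mul_of_bounded hw (hf.summable_norm hN hh x r)

/-! ### Abel summation of the low frequency part. -/

theorem synth_sub_eq (A : ℝ → ℂ) (x t h : ℝ) :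
    synth A (x - t * h) = ∫ ξ, A ξ * wave x ξ * Complex.exp (-(t * freq (h * ξ))) := by
  refine integral_congr_ae (Eventually.of_forall fun ξ => ?_)
  simp only [sub_eq_add_neg, wave_add, wave_neg_mul, mul_assoc]

theorem norm_exp_neg_mul_freq (t ξ : ℝ) : ‖Complex.exp (-(t * freq ξ))‖ = 1 := by
  rw [Complex.norm_exp]
  simp [freq_re]

/-- The Abel factor e^{-ck} makes sum and integral interchangeable and moves the argument of W from
the unit circle strictly inside the disc: z becomes c + `freq (h * ξ)`, with Re z = c > 0. The shift
r produces the compensating factor e^{-rc}. -/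
theorem tsum_mul_exp_mul_synth {w : ℕ → ℝ} {B : ℝ} (hw : ∀ k, |w k| ≤ B) {A : ℝ → ℂ}
    (hA : Integrable A) {c : ℝ} (hc : 0 < c) (h x r : ℝ) :
    ∑' k : ℕ, (Real.exp (-(c * k)) : ℂ) * ((w k : ℂ) * synth A (x - ((k : ℝ) - r) * h))
      = Complex.exp (-(r * c)) * synth (fun ξ => A ξ *
        (genFun w (Complex.exp (-(c + freq (h * ξ)))) * Complex.exp (r * (c + freq (h * ξ))))) x := by
  set Φ : ℕ → ℝ → ℂ := fun k ξ => A ξ * wave x ξ *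
    ((Real.exp (-(c * k)) : ℂ) * (w k : ℂ) * Complex.exp (-(((k : ℝ) - r : ℝ) * freq (h * ξ))))
    with hΦ
  have hterm : ∀ k : ℕ, (Real.exp (-(c * k)) : ℂ) * ((w k : ℂ) * synth A (x - ((k : ℝ) - r) * h))
      = ∫ ξ, Φ k ξ := by
    intro k
    rw [synth_sub_eq, ← mul_assoc, ← integral_const_mul]
    refine integral_congr_ae (Eventually.of_forall fun ξ => ?_)
    simp only [hΦ]
    ring
  have hnorm : ∀ k ξ, ‖Φ k ξ‖ = Real.exp (-(c * k)) * |w k| * ‖A ξ‖ := by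
    intro k ξ
    simp only [hΦ, norm_mul, norm_wave, norm_exp_neg_mul_freq, Complex.norm_real, Real.norm_eq_abs,
      Real.abs_exp]
    ring
  have hint : ∀ k, Integrable (Φ k) := by
    intro k
    refine (integrable_mul_wave hA x).mul_bdd (c := Real.exp (-(c * k)) * |w k|) ?_
      (Eventually.of_forall fun ξ => ?_)
    · exact Continuous.aestronglyMeasurable (by fun_prop)
    · simp [norm_exp_neg_mul_freq, -Complex.ofReal_exp, -Complex.ofReal_sub]
  have hsum : Summable fun k => ∫ ξ, ‖Φ k ξ‖ := by
    have hg : Summable fun k : ℕ => Real.exp (-(c * k)) := by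
      have := Real.summable_exp_nat_mul_iff.mpr (neg_lt_zero.mpr hc)
      refine this.congr fun k => ?_
      ring_nf
    refine Summable.of_nonneg_of_le (fun k => by positivity) (fun k => ?_)
      (hg.mul_right (B * ∫ ξ, ‖A ξ‖))
    simp only [hnorm, integral_const_mul]
    rw [mul_assoc]
    gcongr
    exact hw k
  rw [tsum_congr hterm, integral_tsum_of_summable_integral_norm hint hsum, synth,
    ← integral_const_mul]
  refine integral_congr_ae (Eventually.of_forall fun ξ => ?_)
  simp only [hΦ, tsum_mul_left, genFun]
  have : ∀ k : ℕ, (Real.exp (-(c * k)) : ℂ) * (w k : ℂ) *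
      Complex.exp (-(((k : ℝ) - r : ℝ) * freq (h * ξ))) =
      (Complex.exp (-(r * c)) * Complex.exp (r * (c + freq (h * ξ)))) *
        ((w k : ℂ) * Complex.exp (-(c + freq (h * ξ))) ^ k) := by
    intro k
    rw [← Complex.exp_nat_mul, Complex.ofReal_exp, mul_right_comm, ← Complex.exp_add,
      ← Complex.exp_add, mul_left_comm, ← Complex.exp_add, mul_comm (w k : ℂ)]
    congr 2
    push_cast
    ring
  rw [tsum_congr this, tsum_mul_left]
  ring

theorem genFun_mul_exp (α : ℝ) (w : ℕ → ℝ) (r : ℝ) {z : ℂ} (hz : 0 < z.re) :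
    genFun w (Complex.exp (-z)) * Complex.exp (r * z) = z ^ (α : ℂ) * symbolFun α w r z := by
  have hz0 : z ≠ 0 := by
    rintro rfl
    simp at hz
  have : z ^ (α : ℂ) ≠ 0 := by simp [Complex.cpow_eq_zero_iff, hz0]
  rw [symbolFun]
  field_simp

/-- The series of Grünwald type applied to a band limited function acts as a Fourier multiplier,
by Abel summation. -/
theorem tsum_mul_lowPart {α : ℝ} (hα : 0 < α) {w : ℕ → ℝ} {B : ℝ} (hw : ∀ k, |w k| ≤ B) {r : ℝ}
    {δ : ℝ} (hδ : 0 < δ) {g : ℂ → ℂ} (hg : ContinuousOn g (Metric.ball 0 δ))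
    (hsym : ∀ z ∈ Metric.ball (0 : ℂ) δ, 0 < z.re → symbolFun α w r z = g z)
    {χ : ℝ → ℝ} (hχ : IsCutoff (δ / 2) χ) {f : ℝ → ℂ} (hf : Integrable f)
    (hF : Integrable (𝓕 f)) {h : ℝ} (hh : 0 < h) (x : ℝ) :
    ∑' k : ℕ, (w k : ℂ) * lowPart χ h f (x - ((k : ℝ) - r) * h)
      = synth (fun ξ => χ (h * ξ) * 𝓕 f ξ * (freq (h * ξ) ^ (α : ℂ) * g (freq (h * ξ)))) x := by
  have hsumm := hχ.summable_lowPart (half_pos hδ) hf hh x r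
  have hcut : Continuous fun ξ => (χ (h * ξ) : ℂ) :=
    hχ.contDiff_ofReal.continuous.comp (continuous_const_mul h)
  set A : ℝ → ℂ := fun ξ => (χ (h * ξ) : ℂ) * 𝓕 f ξ with hAdef
  have hA : Integrable A := by
    refine hF.bdd_mul (c := 1) hcut.aestronglyMeasurable (Eventually.of_forall fun ξ => ?_)
    rw [Complex.norm_real, Real.norm_of_nonneg (hχ.nonneg _)]
    exact hχ.le_one _
  have hA0 : ∀ ξ, δ / 2 ≤ ‖freq (h * ξ)‖ → A ξ = 0 := fun ξ hξ => by
    simp [hAdef, hχ.eq_zero _ hξ]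
  have hAm : Measurable A := hcut.measurable.mul (continuous_fourier hf).measurable
  -- For c ≤ δ/4 and ‖`freq (h * ξ)`‖ < δ/2, the argument stays in a compact ball of radius 3δ/4, on
  -- which g is bounded.
  have hball : ∀ c : ℝ, 0 ≤ c → c ≤ δ / 4 → ∀ ξ, ‖freq (h * ξ)‖ < δ / 2 →
      (c : ℂ) + freq (h * ξ) ∈ Metric.closedBall (0 : ℂ) (3 * δ / 4) := by
    intro c hc0 hc ξ hξ
    rw [mem_closedBall_zero_iff]
    refine (norm_add_le _ _).trans ?_
    rw [Complex.norm_real, Real.norm_of_nonneg hc0]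
    linarith
  have hsub : Metric.closedBall (0 : ℂ) (3 * δ / 4) ⊆ Metric.ball 0 δ :=
    Metric.closedBall_subset_ball (by linarith)
  obtain ⟨Cg, hCg⟩ := (isCompact_closedBall (0 : ℂ) (3 * δ / 4)).exists_bound_of_continuousOn
    (hg.mono hsub)
  set Ψ : ℝ → ℝ → ℂ := fun c ξ =>
    A ξ * (((c : ℂ) + freq (h * ξ)) ^ (α : ℂ) * g (c + freq (h * ξ))) with hΨ
  -- Removing the Abel factor from the series is dominated convergence, with the summable majorant B
  -- · ‖`lowPart`‖.
  have hleft : Tendsto (fun c : ℝ => ∑' k : ℕ, (Real.exp (-(c * k)) : ℂ) *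
      ((w k : ℂ) * lowPart χ h f (x - ((k : ℝ) - r) * h))) (𝓝[>] 0)
      (𝓝 (∑' k : ℕ, (w k : ℂ) * lowPart χ h f (x - ((k : ℝ) - r) * h))) := by
    refine tendsto_tsum_of_dominated_convergence (hsumm.mul_left B) (fun k => ?_) ?_
    · have : Continuous fun c : ℝ => (Real.exp (-(c * k)) : ℂ) *
        ((w k : ℂ) * lowPart χ h f (x - ((k : ℝ) - r) * h)) := by fun_prop
      refine tendsto_nhdsWithin_of_tendsto_nhds ?_
      simpa using this.tendsto 0
    · filter_upwards [self_mem_nhdsWithin] with c hc k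
      have hc : 0 < c := hc
      rw [norm_mul, norm_mul, Complex.norm_real, Complex.norm_real, Real.norm_eq_abs,
        Real.norm_eq_abs, Real.abs_exp]
      have : Real.exp (-(c * k)) ≤ 1 := Real.exp_le_one_iff.mpr (by simp; positivity)
      calc _ ≤ 1 * (B * ‖lowPart χ h f (x - ((k : ℝ) - r) * h)‖) := by
            gcongr
            exact hw k
        _ = _ := one_mul _
  -- On the Fourier side c → 0+ is again dominated convergence: the integrand vanishes outside the
  -- cutoff region, and z^α g(z) is bounded on the compact ball and continuous up to the imaginary
  -- axis.
  have hright : Tendsto (fun c : ℝ => Complex.exp (-(r * c)) * synth (Ψ c) x) (𝓝[>] 0)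
      (𝓝 (Complex.exp (-(r * (0 : ℝ))) * synth (Ψ 0) x)) := by
    refine Tendsto.mul ?_ ?_
    · have : Continuous fun c : ℝ => Complex.exp (-(r * c)) := by fun_prop
      exact tendsto_nhdsWithin_of_tendsto_nhds (this.tendsto 0)
    have hbound : ∀ c : ℝ, 0 ≤ c → c ≤ δ / 4 → ∀ ξ,
        ‖Ψ c ξ‖ ≤ ‖A ξ‖ * ((3 * δ / 4) ^ α * Cg) := by
      intro c hc0 hc ξ
      rcases le_or_gt (δ / 2) ‖freq (h * ξ)‖ with hξ | hξ
      · simp [hΨ, hA0 ξ hξ]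
      · have hz := hball c hc0 hc ξ hξ
        simp only [hΨ]
        rw [norm_mul (A ξ), norm_mul (_ ^ _), Complex.norm_cpow_real]
        have hz' := mem_closedBall_zero_iff.mp hz
        gcongr
        exact hCg _ hz
    refine tendsto_integral_filter_of_dominated_convergence
      (fun ξ => ‖A ξ‖ * ((3 * δ / 4) ^ α * Cg)) ?_ ?_ (hA.norm.mul_const _) ?_
    · filter_upwards [Ioo_mem_nhdsGT (show (0 : ℝ) < δ / 4 by positivity)] with c hc
      have hcont : ContinuousOn (fun ξ => g (c + freq (h * ξ)))
          {ξ | ‖freq (h * ξ)‖ < δ / 2} := by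
        refine hg.comp (by fun_prop) fun ξ hξ => hsub (hball c hc.1.le hc.2.le ξ hξ)
      have hopen : IsOpen {ξ : ℝ | ‖freq (h * ξ)‖ < δ / 2} :=
        isOpen_lt (by fun_prop) continuous_const
      have hmeas : AEStronglyMeasurable (Ψ c)
          (volume.restrict {ξ | ‖freq (h * ξ)‖ < δ / 2}) := by
        refine hAm.aestronglyMeasurable.mul (AEStronglyMeasurable.mul ?_
          (hcont.aestronglyMeasurable hopen.measurableSet))
        exact Measurable.aestronglyMeasurable (by fun_prop)
      have hind : Ψ c = Set.indicator {ξ | ‖freq (h * ξ)‖ < δ / 2} (Ψ c) := by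
        symm
        rw [Set.indicator_eq_self]
        intro ξ hξ
        by_contra hcon
        exact hξ (by simp [hΨ, hA0 ξ (not_lt.mp hcon)])
      rw [hind]
      exact ((aestronglyMeasurable_indicator_iff hopen.measurableSet).mpr hmeas).mul
        (continuous_wave x).aestronglyMeasurable
    · filter_upwards [Ioo_mem_nhdsGT (show (0 : ℝ) < δ / 4 by positivity)] with c hc
      refine Eventually.of_forall fun ξ => ?_
      rw [norm_mul, norm_wave, mul_one]
      exact hbound c hc.1.le hc.2.le ξ
    · refine Eventually.of_forall fun ξ => ?_
      refine Tendsto.mul_const _ ?_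
      rcases le_or_gt (δ / 2) ‖freq (h * ξ)‖ with hξ | hξ
      · simp [hΨ, hA0 ξ hξ]
      · have hcont : ContinuousAt (fun z : ℂ => A ξ * (z ^ (α : ℂ) * g z)) (freq (h * ξ)) := by
          refine continuousAt_const.mul ((continuousAt_cpow_freq hα _).mul ?_)
          refine hg.continuousAt (Metric.isOpen_ball.mem_nhds ?_)
          rw [mem_ball_zero_iff]
          linarith
        have hlim : Tendsto (fun c : ℝ => (c : ℂ) + freq (h * ξ)) (𝓝[>] 0)
            (𝓝 (freq (h * ξ))) := by
          have : Continuous fun c : ℝ => (c : ℂ) + freq (h * ξ) := by fun_prop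
          refine tendsto_nhdsWithin_of_tendsto_nhds ?_
          simpa using this.tendsto 0
        simpa [hΨ, Function.comp_def] using hcont.tendsto.comp hlim
  have heq : ∀ᶠ c : ℝ in 𝓝[>] 0, ∑' k : ℕ, (Real.exp (-(c * k)) : ℂ) *
      ((w k : ℂ) * lowPart χ h f (x - ((k : ℝ) - r) * h))
        = Complex.exp (-(r * c)) * synth (Ψ c) x := by
    filter_upwards [Ioo_mem_nhdsGT (show (0 : ℝ) < δ / 4 by positivity)] with c hc
    refine (tsum_mul_exp_mul_synth hw hA hc.1 h x r).trans ?_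
    congr 2
    ext ξ
    rcases le_or_gt (δ / 2) ‖freq (h * ξ)‖ with hξ | hξ
    · simp [hΨ, hA0 ξ hξ]
    · have hre : 0 < ((c : ℂ) + freq (h * ξ)).re := by simpa [freq_re] using hc.1
      simp only [hΨ]
      rw [genFun_mul_exp α w r hre, hsym _ (hsub (hball c hc.1.le hc.2.le ξ hξ)) hre]
  have := tendsto_nhds_unique (hleft.congr' heq) hright
  rw [this]
  simp [hΨ, hAdef]

/-! ### Fractional derivatives as multipliers. -/

/-- The left fractional derivative of order `β`, as a Fourier multiplier. -/
def fracD (β : ℝ) (f : ℝ → ℂ) (x : ℝ) : ℂ := synth (fun ξ => freq ξ ^ (β : ℂ) * 𝓕 f ξ) x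

/-- Positivity of α makes both sides vanish at z = 0, so the exponent law needs no exception at
frequency zero. -/
theorem cpow_natCast_add {α : ℝ} (hα : 0 < α) (l : ℕ) (z : ℂ) :
    z ^ (((l : ℝ) + α : ℝ) : ℂ) = z ^ (α : ℂ) * z ^ l := by
  rcases eq_or_ne z 0 with rfl | hz
  · have h1 : (((l : ℝ) + α : ℝ) : ℂ) ≠ 0 := by
      have : (l : ℝ) + α ≠ 0 := by positivity
      exact_mod_cast this
    have h2 : (α : ℂ) ≠ 0 := by exact_mod_cast hα.ne'
    rw [Complex.zero_cpow h1, Complex.zero_cpow h2, zero_mul]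
  · push_cast
    rw [Complex.cpow_add _ _ hz, Complex.cpow_natCast, mul_comm]

theorem ofReal_mul_cpow {h : ℝ} (hh : 0 < h) (α : ℝ) (z : ℂ) :
    ((h : ℂ) * z) ^ (α : ℂ) = (h ^ α : ℝ) * z ^ (α : ℂ) := by
  rcases eq_or_ne z 0 with rfl | hz
  · rcases eq_or_ne α 0 with rfl | hα
    · simp
    · simp [Complex.zero_cpow (Complex.ofReal_ne_zero.mpr hα)]
  · have hh' : (h : ℂ) ≠ 0 := by exact_mod_cast hh.ne'
    rw [Complex.cpow_def_of_ne_zero (mul_ne_zero hh' hz), Complex.cpow_def_of_ne_zero hz,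
      Complex.log_ofReal_mul hh hz, add_mul, Complex.exp_add, Complex.ofReal_cpow hh.le,
      Complex.cpow_def_of_ne_zero hh', Complex.ofReal_log hh.le]

theorem integral_norm_comp_mul {M : ℝ → ℂ} {h : ℝ} (hh : 0 < h) :
    ∫ ξ, ‖M (h * ξ)‖ = h⁻¹ * ∫ ξ, ‖M ξ‖ := by
  rw [Measure.integral_comp_mul_left (fun ξ => ‖M ξ‖) h, abs_of_pos (inv_pos.mpr hh), smul_eq_mul]

theorem synth_congr {A B : ℝ → ℂ} (h : ∀ ξ, A ξ = B ξ) (x : ℝ) : synth A x = synth B x := by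
  rw [funext h]

theorem synth_add {A B : ℝ → ℂ} (hA : Integrable A) (hB : Integrable B) (x : ℝ) :
    synth (fun ξ => A ξ + B ξ) x = synth A x + synth B x := by
  rw [synth, synth, synth, ← integral_add (integrable_mul_wave hA x) (integrable_mul_wave hB x)]
  simp only [add_mul]

theorem synth_const_mul (c : ℂ) (A : ℝ → ℂ) (x : ℝ) :
    synth (fun ξ => c * A ξ) x = c * synth A x := by
  rw [synth, synth, ← integral_const_mul]
  simp only [mul_assoc]

theorem synth_sum {ι : Type*} (s : Finset ι) {A : ι → ℝ → ℂ} (hA : ∀ i ∈ s, Integrable (A i))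
    (x : ℝ) : synth (fun ξ => ∑ i ∈ s, A i ξ) x = ∑ i ∈ s, synth (A i) x := by
  simp only [synth]
  rw [← integral_finsetSum _ fun i hi => integrable_mul_wave (hA i hi) x]
  simp only [Finset.sum_mul]

theorem rpow_le_natPow_of_le {h : ℝ} (hh : 0 < h) (hh1 : h ≤ 1) {s : ℝ} {m : ℕ} (hs : (m : ℝ) ≤ s) :
    h ^ s ≤ h ^ m := by
  rw [← Real.rpow_natCast h m]
  exact Real.rpow_le_rpow_of_exponent_ge hh hh1 hs

/-! ### Tail and Taylor remainder estimates. -/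

/-- The high frequency part of a fractional derivative. -/
theorem IsCutoff.exists_norm_tail_le {δ : ℝ} {χ : ℝ → ℝ} (hχ : IsCutoff δ χ) {N l : ℕ}
    {f : ℝ → ℂ} (hf : SobolevL1 N f) {α : ℝ} (hl : l + α + 2 ≤ N) :
    ∃ C : ℝ, 0 ≤ C ∧ ∀ h : ℝ, 0 < h → ∀ ξ : ℝ,
      ‖(1 - χ (h * ξ) : ℂ) * (freq ξ ^ (α : ℂ) * freq (h * ξ) ^ l * 𝓕 f ξ)‖
        ≤ C * h ^ ((N : ℝ) - α) * ‖tailMult χ 2 (h * ξ)‖ := by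
  obtain ⟨ρ, hρ, hρχ⟩ := Metric.eventually_nhds_iff.mp hχ.eventually_eq_one
  set A : ℝ := ∫ v, ‖iteratedDeriv N f v‖
  -- Here ρ is a radius on which χ = 1, so t = ‖`freq (h * ξ)`‖ ≥ ρ wherever 1 - χ is nonzero. Of
  -- the power t^(α+l-N), the factor t^(-2) is kept as an integrable majorant; the rest has
  -- nonpositive exponent by `hl` and is bounded by its value at ρ.
  refine ⟨A * ρ ^ (-((N : ℝ) - 2 - α - l)), by positivity, fun h hh ξ => ?_⟩
  set t : ℝ := ‖freq (h * ξ)‖ with ht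
  rcases lt_or_ge |h * ξ| ρ with hlt | hge
  · have : χ (h * ξ) = 1 := hρχ (by simpa using hlt)
    simp [this, tailMult]
  have htρ : ρ ≤ t := hge.trans (abs_le_norm_freq _)
  have ht0 : 0 < t := hρ.trans_le htρ
  have hth : t = h * ‖freq ξ‖ := by
    rw [ht, freq_mul, norm_mul, Complex.norm_real, Real.norm_of_nonneg hh.le]
  have hfreq : ‖freq ξ‖ = t / h := by rw [hth]; field_simp
  have hF : ‖𝓕 f ξ‖ ≤ A * h ^ (N : ℝ) * t ^ (-(N : ℝ)) := by
    have h2 := norm_fourier_le (iteratedDeriv N f) ξ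
    rw [hf.fourier_iteratedDeriv le_rfl, norm_mul, norm_pow, hfreq, div_pow] at h2
    rw [Real.rpow_neg ht0.le, Real.rpow_natCast, Real.rpow_natCast, ← div_eq_mul_inv,
      le_div_iff₀ (by positivity)]
    calc ‖𝓕 f ξ‖ * t ^ N = h ^ N * (t ^ N / h ^ N * ‖𝓕 f ξ‖) := by field_simp
      _ ≤ h ^ N * A := by gcongr
      _ = A * h ^ N := mul_comm _ _
  have htail : ‖tailMult χ 2 (h * ξ)‖ = ‖(1 - χ (h * ξ) : ℂ)‖ * t ^ (-2 : ℝ) := by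
    rw [tailMult, norm_mul, norm_inv, norm_pow, Real.rpow_neg ht0.le]
    norm_cast
  rw [norm_mul, norm_mul, norm_mul, norm_pow, ← ht, Complex.norm_cpow_real, hfreq, htail,
    Real.div_rpow ht0.le hh.le, ← Real.rpow_natCast t l]
  calc ‖(1 - χ (h * ξ) : ℂ)‖ * (t ^ α / h ^ α * t ^ (l : ℝ) * ‖𝓕 f ξ‖)
      ≤ ‖(1 - χ (h * ξ) : ℂ)‖ * (t ^ α / h ^ α * t ^ (l : ℝ) *
          (A * h ^ (N : ℝ) * t ^ (-(N : ℝ)))) := by gcongr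
    _ = ‖(1 - χ (h * ξ) : ℂ)‖ * (A * (h ^ (N : ℝ) / h ^ α) *
          (t ^ (-((N : ℝ) - 2 - α - l)) * t ^ (-2 : ℝ))) := by
        have : t ^ (-((N : ℝ) - 2 - α - l)) * t ^ (-2 : ℝ)
            = t ^ α * t ^ (l : ℝ) * t ^ (-(N : ℝ)) := by
          rw [← Real.rpow_add ht0, ← Real.rpow_add ht0, ← Real.rpow_add ht0]
          congr 1
          ring
        rw [this]
        ring
    _ ≤ ‖(1 - χ (h * ξ) : ℂ)‖ * (A * (h ^ (N : ℝ) / h ^ α) *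
          (ρ ^ (-((N : ℝ) - 2 - α - l)) * t ^ (-2 : ℝ))) := by
        gcongr ‖(1 - χ (h * ξ) : ℂ)‖ * (A * (h ^ (N : ℝ) / h ^ α) * (?_ * t ^ (-2 : ℝ)))
        exact Real.rpow_le_rpow_of_nonpos hρ htρ (by linarith)
    _ = _ := by
        rw [Real.rpow_sub hh]
        ring

/-- Integrating the pointwise bound in the rescaled variable hξ costs one power of h. -/
theorem IsCutoff.exists_norm_synth_tail_le {δ : ℝ} {χ : ℝ → ℝ} (hχ : IsCutoff δ χ) {N l : ℕ}
    {f : ℝ → ℂ} (hf : SobolevL1 N f) {α : ℝ} (hl : l + α + 2 ≤ N) :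
    ∃ C : ℝ, 0 ≤ C ∧ ∀ h : ℝ, 0 < h → ∀ x : ℝ,
      ‖synth (fun ξ => (1 - χ (h * ξ) : ℂ) * (freq ξ ^ (α : ℂ) * freq (h * ξ) ^ l * 𝓕 f ξ)) x‖
        ≤ C * h ^ ((N : ℝ) - 1 - α) := by
  obtain ⟨C, hC, hb⟩ := hχ.exists_norm_tail_le hf hl
  have hi : Integrable (tailMult χ 2) :=
    integrable_of_eq_inv_pow (hχ.contDiff_tailMult 2).continuous le_rfl (hχ.tailMult_eq 2)
  refine ⟨C * ∫ ξ, ‖tailMult χ 2 ξ‖, by positivity, fun h hh x => (norm_synth_le _ x).trans ?_⟩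
  calc _ ≤ ∫ ξ, C * h ^ ((N : ℝ) - α) * ‖tailMult χ 2 (h * ξ)‖ :=
        integral_mono_of_nonneg (Eventually.of_forall fun ξ => norm_nonneg _)
          ((hi.comp_mul_left' hh.ne').norm.const_mul _) (Eventually.of_forall fun ξ => hb h hh ξ)
    _ = _ := by
        rw [integral_const_mul, integral_norm_comp_mul hh,
          show (N : ℝ) - 1 - α = (N - α) - 1 by ring, Real.rpow_sub_one hh.ne']
        ring

theorem exists_norm_le_of_integrable_deriv {g : ℝ → ℂ} (hg : ContDiff ℝ 1 g)
    (hi : Integrable (deriv g)) : ∃ G : ℝ, 0 ≤ G ∧ ∀ x, ‖g x‖ ≤ G := by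
  refine ⟨‖g 0‖ + ∫ y, ‖deriv g y‖, by positivity, fun x => ?_⟩
  have h1 : ∫ y in (0 : ℝ)..x, deriv g y = g x - g 0 :=
    intervalIntegral.integral_deriv_eq_sub
      (fun y _ => (hg.differentiable one_ne_zero).differentiableAt) hi.intervalIntegrable
  have h2 : ‖∫ y in (0 : ℝ)..x, deriv g y‖ ≤ ∫ y, ‖deriv g y‖ :=
    intervalIntegral.norm_integral_le_integral_norm_uIoc.trans
      (setIntegral_le_integral hi.norm (Eventually.of_forall fun _ => norm_nonneg _))
  rw [h1] at h2
  calc ‖g x‖ = ‖g 0 + (g x - g 0)‖ := by simp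
    _ ≤ _ := (norm_add_le _ _).trans (by gcongr)

/-- A Fourier multiplier that is smooth with compact support is bounded in the sup norm,
uniformly in its scale. -/
theorem exists_norm_synth_le_of_bounded {M : ℝ → ℂ} {R : ℝ} (hM : ContDiff ℝ 2 M) (hR : 0 ≤ R)
    (hMR : ∀ ξ, R < |ξ| → M ξ = 0) {g : ℝ → ℂ} (hg : Integrable g) {G : ℝ}
    (hgG : ∀ x, ‖g x‖ ≤ G) :
    ∃ C : ℝ, 0 ≤ C ∧ ∀ h : ℝ, 0 < h → ∀ x, ‖synth (fun ξ => M (h * ξ) * 𝓕 g ξ) x‖ ≤ C := by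
  have hG : 0 ≤ G := (norm_nonneg _).trans (hgG 0)
  have hMR' : ∀ ξ : ℝ, R < |ξ| → M ξ = 0 * ((ξ : ℂ) ^ 2)⁻¹ := fun ξ hξ => by simp [hMR ξ hξ]
  have hi := integrable_of_eq_inv_pow hM.continuous le_rfl hMR'
  obtain ⟨C, hC, hMC⟩ := exists_norm_fourier_le hM le_rfl hR hMR'
  have hFi : Integrable (𝓕 M) := (integrable_inv_one_add_sq.const_mul C).mono'
    (continuous_fourier hi).aestronglyMeasurable (Eventually.of_forall hMC)
  refine ⟨G * ∫ s, ‖𝓕 M s‖, by positivity, fun h hh x => ?_⟩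
  rw [synth_mul_fourier hi hg hh]
  have hcomp : Integrable fun y => 𝓕 M ((y - x) / h) :=
    (hFi.comp_div hh.ne').comp_sub_right x
  calc _ ≤ ∫ y, ‖g y * ((h⁻¹ : ℝ) * 𝓕 M ((y - x) / h))‖ := norm_integral_le_integral_norm _
    _ ≤ ∫ y, G * (h⁻¹ * ‖𝓕 M ((y - x) / h)‖) := by
        refine integral_mono_of_nonneg (Eventually.of_forall fun ξ => norm_nonneg _)
          ((hcomp.norm.const_mul _).const_mul _) (Eventually.of_forall fun y => ?_)
        simp only [norm_mul, Complex.norm_real, Real.norm_of_nonneg (inv_pos.mpr hh).le]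
        gcongr
        exact hgG y
    _ = G * ∫ s, ‖𝓕 M s‖ := by
        rw [integral_const_mul, integral_const_mul,
          integral_sub_right_eq_self (fun y => ‖𝓕 M (y / h)‖) x,
          Measure.integral_comp_div (fun y => ‖𝓕 M y‖) h, abs_of_pos hh, smul_eq_mul]
        field_simp

theorem IsCutoff.contDiff_mul_comp_freq {δ : ℝ} (hδ : 0 < δ) {χ : ℝ → ℝ}
    (hχ : IsCutoff (δ / 2) χ) {H : ℂ → ℂ} (hH : ∀ z ∈ Metric.ball (0 : ℂ) δ, AnalyticAt ℂ H z) :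
    ContDiff ℝ 2 fun ξ => (χ ξ : ℂ) * H (freq ξ) := by
  rw [contDiff_iff_contDiffAt]
  intro ξ
  rcases lt_or_ge ‖freq ξ‖ δ with hξ | hξ
  · refine hχ.contDiff_ofReal.contDiffAt.mul ?_
    have h1 : ContDiffAt ℝ 2 H (freq ξ) :=
      (hH _ (by simpa using hξ)).contDiffAt.restrict_scalars ℝ
    exact h1.comp ξ (contDiffAt_const.mul Complex.ofRealCLM.contDiff.contDiffAt)
  · refine (contDiffAt_const (c := (0 : ℂ))).congr_of_eventuallyEq ?_
    have : ∀ᶠ η in 𝓝 ξ, δ / 2 < ‖freq η‖ :=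
      continuous_freq.norm.continuousAt.eventually (lt_mem_nhds (by linarith))
    filter_upwards [this] with η hη
    simp [hχ.eq_zero _ hη.le]

/-- The contribution of the Taylor remainder of the symbol. -/
theorem IsCutoff.exists_norm_remainder_le {δ : ℝ} (hδ : 0 < δ) {χ : ℝ → ℝ}
    (hχ : IsCutoff (δ / 2) χ) {H : ℂ → ℂ} (hH : ∀ z ∈ Metric.ball (0 : ℂ) δ, AnalyticAt ℂ H z)
    {m n : ℕ} {α : ℝ} (hα : 0 < α) (hαn : α ≤ n) {f : ℝ → ℂ} (hf : SobolevL1 (m + n + 1) f) :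
    ∃ C : ℝ, 0 ≤ C ∧ ∀ h : ℝ, 0 < h → ∀ x : ℝ,
      ‖synth (fun ξ => (χ (h * ξ) * H (freq (h * ξ))) * (freq ξ ^ ((m + α : ℝ) : ℂ) * 𝓕 f ξ)) x‖
        ≤ C := by
  -- For α < n, `freq ξ ^ (m + α)` 𝓕 f is integrable and a sup bound on H suffices. For α = n
  -- integrability is not available; instead f^(m+n) is bounded, since its derivative is integrable,
  -- and the kernel of the multiplier χH has an L¹ norm independent of h.
  rcases hαn.lt_or_eq with hlt | rfl
  · have hint := hf.integrable_cpow_mul_fourier (β := m + α) (by positivity)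
      (by push_cast; linarith)
    obtain ⟨B, hB⟩ := (isCompact_closedBall (0 : ℂ) (δ / 2)).exists_bound_of_continuousOn
      (f := H) fun z hz => (hH z (Metric.closedBall_subset_ball (by linarith) hz)).continuousAt
        |>.continuousWithinAt
    have hB0 : 0 ≤ B := (norm_nonneg _).trans (hB 0 (by simp; positivity))
    refine ⟨B * ∫ ξ, ‖freq ξ ^ ((m + α : ℝ) : ℂ) * 𝓕 f ξ‖, by positivity,
      fun h hh x => (norm_synth_le _ x).trans ?_⟩
    rw [← integral_const_mul]
    refine integral_mono_of_nonneg (Eventually.of_forall fun ξ => norm_nonneg _)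
      (hint.norm.const_mul _) (Eventually.of_forall fun ξ => ?_)
    simp only []
    rw [norm_mul]
    gcongr
    rcases le_or_gt (δ / 2) ‖freq (h * ξ)‖ with hξ | hξ
    · simpa [hχ.eq_zero _ hξ] using hB0
    · rw [norm_mul, Complex.norm_real, Real.norm_of_nonneg (hχ.nonneg _)]
      exact (mul_le_of_le_one_left (norm_nonneg _) (hχ.le_one _)).trans
        (hB _ (by simpa using hξ.le))
  · have hM := hχ.contDiff_mul_comp_freq hδ hH
    have hk : ContDiff ℝ 1 (iteratedDeriv (m + n) f) := by
      rw [iteratedDeriv_eq_iterate]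
      exact ContDiff.iterate_deriv' 1 (m + n) (by
        rw [add_comm]
        exact_mod_cast hf.1)
    obtain ⟨G, _, hG⟩ := exists_norm_le_of_integrable_deriv hk (by
      rw [← iteratedDeriv_succ]
      exact hf.2 _ le_rfl)
    obtain ⟨C, hC, hb⟩ := exists_norm_synth_le_of_bounded hM (half_pos hδ).le
      (fun ξ hξ => by simp [hχ.eq_zero_of_lt_abs hξ]) (hf.2 (m + n) (by omega)) hG
    refine ⟨C, hC, fun h hh x => le_of_eq_of_le (congrArg norm (synth_congr (fun ξ => ?_) x))
      (hb h hh x)⟩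
    rw [hf.fourier_iteratedDeriv (by omega)]
    have : (((m : ℝ) + (n : ℝ) : ℝ) : ℂ) = ((m + n : ℕ) : ℂ) := by push_cast; ring
    rw [this, Complex.cpow_natCast]

theorem norm_tsum_mul_le_of_sum_le {w : ℕ → ℝ} {B : ℝ} (hw : ∀ k, |w k| ≤ B) {u : ℕ → ℂ} {K : ℝ}
    (hu : ∀ S : Finset ℕ, ∑ k ∈ S, ‖u k‖ ≤ K) : ‖∑' k, (w k : ℂ) * u k‖ ≤ B * K := by
  have hB : 0 ≤ B := (abs_nonneg _).trans (hw 0)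
  have hs : Summable fun k => ‖u k‖ := summable_of_sum_le (fun _ => norm_nonneg _) hu
  refine (tsum_of_norm_bounded (hs.mul_left B).hasSum fun k => ?_).trans ?_
  · rw [norm_mul, Complex.norm_real]
    exact mul_le_mul_of_nonneg_right (hw k) (norm_nonneg _)
  · rw [tsum_mul_left]
    gcongr
    exact hs.tsum_le_of_sum_le hu

/-- Compact support in ξ gives integrability for every β > 0, including β = m + n, where decay of 𝓕
f alone would not suffice. -/
theorem IsCutoff.integrable_remainder {δ : ℝ} (hδ : 0 < δ) {χ : ℝ → ℝ}
    (hχ : IsCutoff (δ / 2) χ) {H : ℂ → ℂ} (hH : ∀ z ∈ Metric.ball (0 : ℂ) δ, AnalyticAt ℂ H z)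
    {β : ℝ} (hβ : 0 < β) {f : ℝ → ℂ} (hf : Integrable f) {h : ℝ} (hh : 0 < h) :
    Integrable fun ξ => (χ (h * ξ) * H (freq (h * ξ))) * (freq ξ ^ (β : ℂ) * 𝓕 f ξ) := by
  have h1 : Continuous fun ξ => (χ (h * ξ) : ℂ) * H (freq (h * ξ)) :=
    (hχ.contDiff_mul_comp_freq hδ hH).continuous.comp (continuous_const_mul h)
  have h2 : Continuous fun ξ => freq ξ ^ (β : ℂ) := continuous_iff_continuousAt.mpr fun ξ =>
    ContinuousAt.comp (f := freq) (continuousAt_cpow_freq hβ ξ) continuous_freq.continuousAt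
  refine (h1.mul (h2.mul (continuous_fourier hf))).integrable_of_hasCompactSupport ?_
  refine HasCompactSupport.intro (isCompact_closedBall (0 : ℝ) (δ / 2 / h)) fun ξ hξ => ?_
  have : δ / 2 < |h * ξ| := by
    rw [mem_closedBall_zero_iff, not_le, div_lt_iff₀ hh] at hξ
    rwa [abs_mul, abs_of_pos hh, mul_comm]
  simp [hχ.eq_zero_of_lt_abs this]

/-! ### The error expansion. -/

/-- Error expansion: if the symbol is `∑ l < m, a l * z ^ l + O(z ^ m)`, then the Grünwald
operator is `∑ l < m, h ^ l * a l * D^(l + α) + O(h ^ m)`, uniformly. -/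
theorem uniformBigO_leftOp_sub_sum {m n : ℕ} (hm : 1 ≤ m) {α : ℝ} (hα : 0 < α) (hαn : α ≤ n)
    {w : ℕ → ℝ} {B : ℝ} (hw : ∀ k, |w k| ≤ B) {r : ℝ} {a : ℕ → ℂ} {H : ℂ → ℂ}
    (hH : AnalyticAt ℂ H 0)
    (hsym : ∀ᶠ z in rightHalfNhds,
      symbolFun α w r z = ∑ l ∈ Finset.range m, a l * z ^ l + z ^ m * H z)
    {f : ℝ → ℂ} (hf : SobolevL1 (m + n + 1) f) :
    UniformBigO (fun h x => leftOp α w r h f x -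
      ∑ l ∈ Finset.range m, (h : ℂ) ^ l * a l * fracD ((l : ℝ) + α) f x) m := by
  have hn : 1 ≤ n := by
    have : (0 : ℝ) < n := hα.trans_le hαn
    exact_mod_cast this
  have hN : 2 ≤ m + n + 1 := by omega
  obtain ⟨δ₁, hδ₁, hH₁⟩ := Metric.eventually_nhds_iff_ball.mp hH.eventually_analyticAt
  obtain ⟨δ₂, hδ₂, hs₂⟩ := Metric.mem_nhdsWithin_iff.mp hsym
  set δ := min δ₁ δ₂
  have hδ : 0 < δ := lt_min hδ₁ hδ₂
  have hHδ : ∀ z ∈ Metric.ball (0 : ℂ) δ, AnalyticAt ℂ H z := fun z hz =>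
    hH₁ z (Metric.ball_subset_ball (min_le_left _ _) hz)
  set g : ℂ → ℂ := fun z => ∑ l ∈ Finset.range m, a l * z ^ l + z ^ m * H z with hg
  have hgc : ContinuousOn g (Metric.ball 0 δ) := by
    refine ContinuousOn.add (by fun_prop) (ContinuousOn.mul (by fun_prop) fun z hz => ?_)
    exact (hHδ z hz).continuousAt.continuousWithinAt
  have hgs : ∀ z ∈ Metric.ball (0 : ℂ) δ, 0 < z.re → symbolFun α w r z = g z := fun z hz hre =>
    hs₂ ⟨Metric.ball_subset_ball (min_le_right _ _) hz, hre⟩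
  obtain ⟨χ, hχ⟩ := exists_isCutoff (half_pos hδ)
  obtain ⟨K, hK0, hK⟩ := hχ.exists_sum_norm_sub_lowPart_le (half_pos hδ) hN hf
  obtain ⟨C₁, hC₁, hR⟩ := hχ.exists_norm_remainder_le hδ hHδ hα hαn hf
  -- The guard l < m, with constant 0 beyond it, lets `choose` produce a total sequence of
  -- constants.
  have htail : ∀ l : ℕ, ∃ C : ℝ, 0 ≤ C ∧ (l < m → ∀ h : ℝ, 0 < h → ∀ x : ℝ,
      ‖synth (fun ξ => (1 - χ (h * ξ) : ℂ) * (freq ξ ^ (α : ℂ) * freq (h * ξ) ^ l * 𝓕 f ξ)) x‖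
        ≤ C * h ^ (((m + n + 1 : ℕ) : ℝ) - 1 - α)) := by
    intro l
    by_cases hl : l < m
    · have hl' : (l : ℝ) + 1 ≤ m := by exact_mod_cast hl
      obtain ⟨C, hC, hb⟩ := hχ.exists_norm_synth_tail_le (l := l) hf (α := α)
        (by push_cast; linarith)
      exact ⟨C, hC, fun _ => hb⟩
    · exact ⟨0, le_rfl, fun h => absurd h hl⟩
  choose C₂ hC₂ hT using htail
  have hFi := hf.integrable_fourier hN
  have hP : ∀ l < m, Integrable fun ξ => freq ξ ^ (((l : ℝ) + α : ℝ) : ℂ) * 𝓕 f ξ := by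
    intro l hl
    have hl' : (l : ℝ) + 1 ≤ m := by exact_mod_cast hl
    exact hf.integrable_cpow_mul_fourier (by positivity) (by push_cast; linarith)
  refine ⟨B * K + (∑ l ∈ Finset.range m, ‖a l‖ * C₂ l + C₁), 1, one_pos, fun h hh hh1 x => ?_⟩
  -- The exponent equals m + n - α ≥ m; this is where α ≤ n meets the m + n + 1 derivatives.
  have hpow : h ^ (((m + n + 1 : ℕ) : ℝ) - 1 - α) ≤ h ^ m :=
    rpow_le_natPow_of_le hh hh1.le (by push_cast; linarith)
  have hQ : ∀ l < m, Integrable fun ξ =>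
      (1 - χ (h * ξ) : ℂ) * (freq ξ ^ (α : ℂ) * freq (h * ξ) ^ l * 𝓕 f ξ) := by
    intro l hl
    refine (((hP l hl).const_mul ((h : ℂ) ^ l)).bdd_mul (c := 1)
      (f := fun ξ => (1 - χ (h * ξ) : ℂ)) ?_ (Eventually.of_forall fun ξ => ?_)).congr
      (Eventually.of_forall fun ξ => ?_)
    · exact (continuous_const.sub (hχ.contDiff_ofReal.continuous.comp
        (continuous_const_mul h))).aestronglyMeasurable
    · rw [← Complex.ofReal_one, ← Complex.ofReal_sub, Complex.norm_real, Real.norm_of_nonneg]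
      · linarith [hχ.nonneg (h * ξ)]
      · linarith [hχ.le_one (h * ξ)]
    · simp only [cpow_natCast_add hα, freq_mul]
      ring
  have hRi := hχ.integrable_remainder hδ hHδ (β := (m : ℝ) + α) (by positivity) hf.integrable hh
  have hPs : Integrable fun ξ => ∑ l ∈ Finset.range m,
      (h : ℂ) ^ l * a l * (freq ξ ^ (((l : ℝ) + α : ℝ) : ℂ) * 𝓕 f ξ) :=
    integrable_finsetSum _ fun l hl => (hP l (Finset.mem_range.mp hl)).const_mul _
  have hQs : Integrable fun ξ => ∑ l ∈ Finset.range m, -a l *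
      ((1 - χ (h * ξ) : ℂ) * (freq ξ ^ (α : ℂ) * freq (h * ξ) ^ l * 𝓕 f ξ)) :=
    integrable_finsetSum _ fun l hl => (hQ l (Finset.mem_range.mp hl)).const_mul _
  have hRm := hRi.const_mul ((h : ℂ) ^ m)
  have hQR : Integrable fun ξ => (∑ l ∈ Finset.range m, -a l *
      ((1 - χ (h * ξ) : ℂ) * (freq ξ ^ (α : ℂ) * freq (h * ξ) ^ l * 𝓕 f ξ))) +
      (h : ℂ) ^ m * ((χ (h * ξ) * H (freq (h * ξ))) *
        (freq ξ ^ (((m : ℝ) + α : ℝ) : ℂ) * 𝓕 f ξ)) := hQs.add hRm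
  -- Writing χ = 1 - (1 - χ) in each Taylor term gives a full fractional derivative minus a high
  -- frequency tail; only the remainder keeps its cutoff.
  have hlow : ((1 / h ^ α : ℝ) : ℂ) * ∑' k : ℕ, (w k : ℂ) * lowPart χ h f (x - ((k : ℝ) - r) * h)
      = (∑ l ∈ Finset.range m, (h : ℂ) ^ l * a l * fracD ((l : ℝ) + α) f x)
        + ((∑ l ∈ Finset.range m, -a l * synth (fun ξ => (1 - χ (h * ξ) : ℂ) *
          (freq ξ ^ (α : ℂ) * freq (h * ξ) ^ l * 𝓕 f ξ)) x)
        + (h : ℂ) ^ m * synth (fun ξ => (χ (h * ξ) * H (freq (h * ξ))) *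
          (freq ξ ^ (((m : ℝ) + α : ℝ) : ℂ) * 𝓕 f ξ)) x) := by
    rw [tsum_mul_lowPart hα hw hδ hgc hgs hχ hf.integrable hFi hh, ← synth_const_mul,
      ← synth_const_mul]
    simp only [fracD, ← synth_const_mul]
    rw [← synth_sum _ fun l hl => (hP l (Finset.mem_range.mp hl)).const_mul _,
      ← synth_sum _ fun l hl => (hQ l (Finset.mem_range.mp hl)).const_mul _,
      ← synth_add hQs hRm, ← synth_add hPs hQR]
    refine synth_congr (fun ξ => ?_) x
    have hhα : ((h ^ α : ℝ) : ℂ) ≠ 0 := by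
      exact_mod_cast (Real.rpow_pos_of_pos hh α).ne'
    simp only [cpow_natCast_add hα, freq_mul, ofReal_mul_cpow hh, hg]
    rw [← add_assoc, ← Finset.sum_add_distrib]
    have hsum : ∀ l ∈ Finset.range m,
        (h : ℂ) ^ l * a l * (freq ξ ^ (α : ℂ) * freq ξ ^ l * 𝓕 f ξ) +
          -a l * ((1 - (χ (h * ξ) : ℂ)) * (freq ξ ^ (α : ℂ) * (h * freq ξ) ^ l * 𝓕 f ξ))
        = χ (h * ξ) * freq ξ ^ (α : ℂ) * 𝓕 f ξ * (a l * (h * freq ξ) ^ l) := by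
      intro l _
      ring
    rw [Finset.sum_congr rfl hsum, ← Finset.mul_sum]
    push_cast
    rw [show (1 / ((h ^ α : ℝ) : ℂ)) = ((h ^ α : ℝ) : ℂ)⁻¹ from one_div _]
    field_simp
    ring
  have hsplit : leftOp α w r h f x = ((1 / h ^ α : ℝ) : ℂ) * ∑' k : ℕ, (w k : ℂ) *
        (f (x - ((k : ℝ) - r) * h) - lowPart χ h f (x - ((k : ℝ) - r) * h)) +
      ((1 / h ^ α : ℝ) : ℂ) * ∑' k : ℕ, (w k : ℂ) * lowPart χ h f (x - ((k : ℝ) - r) * h) := by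
    rw [leftOp, ← mul_add, ← Summable.tsum_add]
    · congr 2
      ext k
      ring
    · exact summable_mul_of_bounded hw
        (summable_of_sum_le (fun _ => norm_nonneg _) fun S => hK h hh x r S)
    · exact summable_mul_of_bounded hw (hχ.summable_lowPart (half_pos hδ) hf.integrable hh x r)
  beta_reduce
  rw [hsplit, hlow, add_sub_assoc, add_sub_cancel_left, add_mul, add_mul]
  refine norm_add_le_of_le ?_ (norm_add_le_of_le ?_ ?_)
  · have h1 := norm_tsum_mul_le_of_sum_le hw fun S => hK h hh x r S
    rw [norm_mul, Complex.norm_real, Real.norm_of_nonneg (by positivity)]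
    have hB : 0 ≤ B := (abs_nonneg _).trans (hw 0)
    calc _ ≤ 1 / h ^ α * (B * (h ^ (m + n + 1) * h⁻¹ * K)) := by gcongr
      _ = B * K * h ^ (((m + n + 1 : ℕ) : ℝ) - 1 - α) := by
          rw [Real.rpow_sub hh, Real.rpow_sub_one hh.ne', Real.rpow_natCast]
          ring
      _ ≤ B * K * h ^ m := by gcongr
  · rw [Finset.sum_mul]
    refine norm_sum_le_of_le _ fun l hl => ?_
    rw [norm_mul, norm_neg, mul_assoc]
    gcongr
    exact (hT l (Finset.mem_range.mp hl) h hh x).trans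
      (mul_le_mul_of_nonneg_left hpow (hC₂ l))
  · rw [norm_mul, norm_pow, Complex.norm_real, Real.norm_of_nonneg hh.le, mul_comm]
    gcongr
    exact hR h hh x

/-! ### Grünwald-Letnikov weights and existence of the derivatives. -/

theorem glWeight_succ (β : ℝ) (k : ℕ) :
    glWeight β (k + 1) * (k + 1) = glWeight β k * (k - β) := by
  have h : Ring.choose β (k + 1) * (k + 1) = Ring.choose β k * (β - k) := by
    have h1 := Ring.choose_smul_choose β (Nat.le_succ k)
    simpa [Ring.choose_one_right, mul_comm] using h1
  simp only [glWeight, pow_succ]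
  linear_combination (-(-1) ^ k) * h

/-- The ratio of consecutive weights is (k - β)/(k + 1), of modulus at most 1 once k ≥ β, so the
absolute values eventually decrease. -/
theorem exists_abs_glWeight_le {β : ℝ} (hβ : 0 < β) : ∃ B : ℝ, ∀ k : ℕ, |glWeight β k| ≤ B := by
  obtain ⟨K, hK⟩ := exists_nat_ge β
  have hstep : ∀ k, K ≤ k → |glWeight β (k + 1)| ≤ |glWeight β k| := by
    intro k hk
    have hk' : (K : ℝ) ≤ k := by exact_mod_cast hk
    have h1 := congrArg abs (glWeight_succ β k)
    rw [abs_mul, abs_mul, abs_of_nonneg (by linarith : (0 : ℝ) ≤ k - β),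
      abs_of_nonneg (by positivity : (0 : ℝ) ≤ (k : ℝ) + 1)] at h1
    have h2 : |glWeight β k| * (k - β) ≤ |glWeight β k| * (k + 1) :=
      mul_le_mul_of_nonneg_left (by linarith) (abs_nonneg _)
    exact le_of_mul_le_mul_right (h1.trans_le h2) (by positivity)
  have htail : ∀ k, K ≤ k → |glWeight β k| ≤ |glWeight β K| := by
    intro k hk
    induction k, hk using Nat.le_induction with
    | base => rfl
    | succ k hk ih => exact (hstep k hk).trans ih
  refine ⟨∑ j ∈ Finset.range (K + 1), |glWeight β j|, fun k => ?_⟩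
  have hmem : ∀ j ≤ K, |glWeight β j| ≤ ∑ j ∈ Finset.range (K + 1), |glWeight β j| := fun j hj =>
    Finset.single_le_sum (f := fun j => |glWeight β j|) (fun _ _ => abs_nonneg _)
      (Finset.mem_range.mpr (by omega))
  rcases le_total k K with hk | hk
  · exact hmem k hk
  · exact (htail k hk).trans (hmem K le_rfl)

theorem genFun_glWeight (β : ℝ) {ζ : ℂ} (hζ : ‖ζ‖ < 1) :
    genFun (glWeight β) ζ = (1 - ζ) ^ (β : ℂ) := by
  have hmem : -ζ ∈ Metric.eball (0 : ℂ) 1 := by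
    rw [← ENNReal.ofReal_one, Metric.eball_ofReal]
    simpa using hζ
  have h := (Complex.one_add_cpow_hasFPowerSeriesOnBall_zero (a := (β : ℂ))).hasSum hmem
  rw [zero_add, ← sub_eq_add_neg] at h
  rw [genFun, ← h.tsum_eq]
  refine tsum_congr fun k => ?_
  have hc : Ring.choose (β : ℂ) k = (Ring.choose β k : ℝ) :=
    (Ring.map_choose (algebraMap ℝ ℂ) β k).symm
  rw [binomialSeries_apply, hc]
  simp only [glWeight, List.ofFn_const, List.prod_replicate, smul_eq_mul]
  rw [neg_pow]
  push_cast
  ring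

/-- Both arguments lie in (-π/2, π/2), so their sum stays in the principal range. -/
theorem mul_cpow_of_re_pos {z q : ℂ} (hz : 0 < z.re) (hq : 0 < q.re) (β : ℂ) :
    (z * q) ^ β = z ^ β * q ^ β := by
  have hz0 : z ≠ 0 := by
    rintro rfl
    simp at hz
  have hq0 : q ≠ 0 := by
    rintro rfl
    simp at hq
  have h1 := abs_lt.mp (Complex.abs_arg_lt_pi_div_two_iff.mpr (Or.inl hz))
  have h2 := abs_lt.mp (Complex.abs_arg_lt_pi_div_two_iff.mpr (Or.inl hq))
  rw [Complex.cpow_def_of_ne_zero (mul_ne_zero hz0 hq0), Complex.cpow_def_of_ne_zero hz0,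
    Complex.cpow_def_of_ne_zero hq0,
    Complex.log_mul hz0 hq0 ⟨by linarith [h1.1, h2.1], by linarith [h1.2, h2.2]⟩, add_mul,
    Complex.exp_add]

theorem analyticAt_dslope {g : ℂ → ℂ} {z : ℂ} (hg : AnalyticAt ℂ g z) :
    AnalyticAt ℂ (dslope g z) z := by
  obtain ⟨q, hq⟩ := hg
  exact ⟨_, hq.has_fpower_series_dslope_fslope⟩

theorem eq_add_mul_dslope (g : ℂ → ℂ) (z : ℂ) : g z = g 0 + z * dslope g 0 z := by
  have := sub_smul_dslope g 0 z
  rw [sub_zero, smul_eq_mul] at this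
  rw [this]
  ring

/-- The symbol of the Grünwald-Letnikov difference is `1 + O(z)`. -/
theorem exists_symbolFun_glWeight (β : ℝ) :
    ∃ H : ℂ → ℂ, AnalyticAt ℂ H 0 ∧
      ∀ᶠ z in rightHalfNhds, symbolFun β (glWeight β) 0 z = 1 + z * H z := by
  set e : ℂ → ℂ := fun z => 1 - Complex.exp (-z) with he
  have hea : AnalyticAt ℂ e 0 := by fun_prop
  have hder : HasDerivAt e 1 0 := by
    have h1 : HasDerivAt (fun z : ℂ => -z) (-1) 0 := (hasDerivAt_id 0).neg
    simpa using h1.cexp.const_sub 1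
  -- q is (1 - e^{-z})/z with its singularity removed; q(0) = 1 makes q^β analytic at 0, and a
  -- second divided slope supplies H.
  set q : ℂ → ℂ := dslope e 0 with hq
  have hqa : AnalyticAt ℂ q 0 := analyticAt_dslope hea
  have hq0 : q 0 = 1 := by rw [hq, dslope_same, hder.deriv]
  have hslit : q 0 ∈ Complex.slitPlane := by simp [hq0]
  have hga : AnalyticAt ℂ (fun z => q z ^ (β : ℂ)) 0 := hqa.cpow analyticAt_const hslit
  refine ⟨dslope (fun z => q z ^ (β : ℂ)) 0, analyticAt_dslope hga, ?_⟩
  have hre : ∀ᶠ z in rightHalfNhds, 0 < (q z).re := by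
    refine nhdsWithin_le_nhds ?_
    have : ContinuousAt (fun z => (q z).re) 0 :=
      Complex.continuous_re.continuousAt.comp hqa.continuousAt
    exact this.eventually (lt_mem_nhds (by simp [hq0]))
  have hpos : ∀ᶠ z in rightHalfNhds, 0 < z.re := self_mem_nhdsWithin
  filter_upwards [hre, hpos] with z hz1 hz2
  have hz0 : z ≠ 0 := by
    rintro rfl
    simp at hz2
  have hzβ : z ^ (β : ℂ) ≠ 0 := by simp [Complex.cpow_eq_zero_iff, hz0]
  have hez : e z = z * q z := by
    rw [eq_add_mul_dslope e z]
    simp [he, hq]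
  have hexp : ‖Complex.exp (-z)‖ < 1 := by
    rw [Complex.norm_exp]
    simpa using hz2
  have h1 := eq_add_mul_dslope (fun z => q z ^ (β : ℂ)) z
  simp only [hq0, Complex.one_cpow] at h1
  rw [← h1, symbolFun, genFun_glWeight β hexp]
  change 1 / z ^ (β : ℂ) * (e z) ^ (β : ℂ) * _ = _
  rw [hez, mul_cpow_of_re_pos hz2 hz1]
  simp only [Complex.ofReal_zero, zero_mul, Complex.exp_zero, mul_one]
  field_simp

theorem UniformBigO.isBigO {E : ℝ → ℝ → ℂ} {q : ℕ} (h : UniformBigO E q) (x : ℝ) :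
    (fun h : ℝ => E h x) =O[𝓝[>] 0] fun h : ℝ => h ^ q := by
  obtain ⟨C, h₀, hh₀, hC⟩ := h
  refine Asymptotics.IsBigO.of_bound C ?_
  filter_upwards [Ioo_mem_nhdsGT hh₀] with h hh
  rw [norm_pow, Real.norm_of_nonneg hh.1.le]
  exact hC h hh.1 hh.2 x

theorem tendsto_pow_nhdsGT {q : ℕ} (hq : 1 ≤ q) :
    Tendsto (fun h : ℝ => h ^ q) (𝓝[>] 0) (𝓝 0) := by
  refine tendsto_nhdsWithin_of_tendsto_nhds ?_
  simpa [zero_pow (by omega : q ≠ 0)] using (continuous_pow q).tendsto (0 : ℝ)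

/-- The Grünwald-Letnikov derivative of order `β ≤ n` exists for functions in `W^{n+2,1}`. -/
theorem hasLeftDeriv_fracD {n : ℕ} {β : ℝ} (hβ : 0 < β) (hβn : β ≤ n) {f : ℝ → ℂ}
    (hf : SobolevL1 (n + 2) f) (x : ℝ) : HasLeftDeriv β f x (fracD β f x) := by
  obtain ⟨B, hB⟩ := exists_abs_glWeight_le hβ
  obtain ⟨H, hH, hsym⟩ := exists_symbolFun_glWeight β
  refine ⟨leftConverges_of_bounded hB (by omega) hf 0 x, ?_⟩
  have hf' : SobolevL1 (1 + n + 1) f := by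
    rwa [show 1 + n + 1 = n + 2 by ring]
  -- The expansion with m = 1 and leading coefficient 1 gives an error O(h), so the limit exists.
  have h1 := (uniformBigO_leftOp_sub_sum le_rfl hβ hβn hB (a := fun _ => 1) hH
    (hsym.mono fun z hz => by simpa using hz) hf').isBigO x
  have h2 := h1.trans_tendsto (tendsto_pow_nhdsGT le_rfl)
  simp only [Finset.range_one, Finset.sum_singleton, pow_zero, Nat.cast_zero, zero_add,
    one_mul] at h2
  simpa using h2.add_const (fracD β f x)

/-! ### Reflection between left and right. -/

theorem SobolevL1.mono {M N : ℕ} {f : ℝ → ℂ} (hf : SobolevL1 N f) (h : M ≤ N) : SobolevL1 M f :=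
  ⟨hf.1.of_le (by exact_mod_cast h), fun k hk => hf.2 k (hk.trans h)⟩

theorem SobolevL1.comp_neg {N : ℕ} {f : ℝ → ℂ} (hf : SobolevL1 N f) :
    SobolevL1 N fun x => f (-x) := by
  refine ⟨hf.1.comp contDiff_neg, fun k hk => ?_⟩
  have : iteratedDeriv k (fun x => f (-x)) = fun x => (-1 : ℝ) ^ k • iteratedDeriv k f (-x) := by
    ext x
    exact iteratedDeriv_comp_neg k f x
  rw [this]
  exact (hf.2 k hk).comp_neg.smul ((-1 : ℝ) ^ k)

theorem rightOp_eq_leftOp (α : ℝ) (w : ℕ → ℝ) (r h : ℝ) (f : ℝ → ℂ) (x : ℝ) :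
    rightOp α w r h f x = leftOp α w r h (fun y => f (-y)) (-x) := by
  simp only [rightOp, leftOp]
  congr 2
  ext k
  ring_nf

theorem rightConverges_iff (w : ℕ → ℝ) (r : ℝ) (f : ℝ → ℂ) (x : ℝ) :
    RightConverges w r f x ↔ LeftConverges w r (fun y => f (-y)) (-x) := by
  refine forall₂_congr fun h _ => summable_congr fun k => ?_
  ring_nf

theorem hasRightDeriv_iff (β : ℝ) (f : ℝ → ℂ) (x : ℝ) (d : ℂ) :
    HasRightDeriv β f x d ↔ HasLeftDeriv β (fun y => f (-y)) (-x) d := by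
  simp only [HasRightDeriv, HasLeftDeriv, rightConverges_iff, rightOp_eq_leftOp]

theorem UniformBigO.comp {E : ℝ → ℝ → ℂ} {q : ℕ} (h : UniformBigO E q) (φ : ℝ → ℝ) :
    UniformBigO (fun h x => E h (φ x)) q := by
  obtain ⟨C, h₀, hh₀, hC⟩ := h
  exact ⟨C, h₀, hh₀, fun h h0 h1 x => hC h h0 h1 (φ x)⟩

/-! ### Taylor coefficients and their uniqueness. -/

theorem exists_taylor {g : ℂ → ℂ} (hg : AnalyticAt ℂ g 0) (m : ℕ) :
    ∃ (a : ℕ → ℂ) (H : ℂ → ℂ), AnalyticAt ℂ H 0 ∧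
      ∀ z, g z = ∑ l ∈ Finset.range m, a l * z ^ l + z ^ m * H z := by
  induction m with
  | zero => exact ⟨0, g, hg, fun z => by simp⟩
  | succ m ih =>
    obtain ⟨a, H, hH, h⟩ := ih
    refine ⟨Function.update a m (H 0), dslope H 0, analyticAt_dslope hH, fun z => ?_⟩
    rw [Finset.sum_range_succ, Function.update_self, h z,
      Finset.sum_congr rfl fun l hl => by
        rw [← Function.update_of_ne (Finset.mem_range.mp hl).ne (H 0) a]]
    rw [eq_add_mul_dslope H z]
    ring

/-- Letting h → 0+ kills the constant coefficient; dividing by h > 0 lowers the degree. -/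
theorem eq_zero_of_sum_isBigO {p : ℕ} {c : ℕ → ℂ}
    (h : (fun h : ℝ => ∑ l ∈ Finset.range p, (h : ℂ) ^ l * c l) =O[𝓝[>] 0] fun h : ℝ => h ^ p) :
    ∀ l < p, c l = 0 := by
  induction p generalizing c with
  | zero => simp
  | succ p ih =>
    have h0 : c 0 = 0 := by
      have hcont : Continuous fun h : ℝ => ∑ l ∈ Finset.range (p + 1), (h : ℂ) ^ l * c l := by
        fun_prop
      have h1 : Tendsto (fun h : ℝ => ∑ l ∈ Finset.range (p + 1), (h : ℂ) ^ l * c l) (𝓝[>] 0)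
          (𝓝 (c 0)) := by
        refine tendsto_nhdsWithin_of_tendsto_nhds ?_
        have := hcont.tendsto 0
        rw [Finset.sum_range_succ'] at this
        simpa using this
      exact tendsto_nhds_unique h1 (h.trans_tendsto (tendsto_pow_nhdsGT (by omega)))
    have h2 := ih (c := fun l => c (l + 1)) <| by
      obtain ⟨C, hC⟩ := h.bound
      refine Asymptotics.IsBigO.of_bound C ?_
      filter_upwards [hC, self_mem_nhdsWithin] with h hh hpos
      have hpos : 0 < h := hpos
      rw [Finset.sum_range_succ', h0, mul_zero, add_zero] at hh
      have h3 : ∑ l ∈ Finset.range p, (h : ℂ) ^ (l + 1) * c (l + 1)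
          = h * ∑ l ∈ Finset.range p, (h : ℂ) ^ l * c (l + 1) := by
        rw [Finset.mul_sum]
        exact Finset.sum_congr rfl fun l _ => by ring
      rw [h3, norm_mul, Complex.norm_real, pow_succ, norm_mul, ← mul_assoc, mul_comm] at hh
      exact le_of_mul_le_mul_right hh (by simpa using hpos.ne')
    intro l hl
    rcases l with _ | l
    · exact h0
    · exact h2 l (by omega)

theorem tendsto_ofReal_rightHalfNhds :
    Tendsto (fun h : ℝ => (h : ℂ)) (𝓝[>] 0) rightHalfNhds := by
  refine tendsto_nhdsWithin_iff.mpr ⟨?_, ?_⟩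
  · refine tendsto_nhdsWithin_of_tendsto_nhds ?_
    simpa using Complex.continuous_ofReal.tendsto 0
  · filter_upwards [self_mem_nhdsWithin] with h hh
    simpa using hh

/-- If D^β f vanished identically, Fourier inversion would make `freq ξ ^ β` 𝓕 f zero, hence 𝓕 f
zero off the null set {0}, and then f = 0. -/
theorem fracD_ne_zero {N : ℕ} {f : ℝ → ℂ} (hf : SobolevL1 N f) (hf0 : f ≠ 0) {β : ℝ} (hβ : 0 < β)
    (hβN : β + 1 < N) : ∃ x, fracD β f x ≠ 0 := by
  by_contra! hcon
  refine hf0 ?_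
  have hN : 2 ≤ N := by
    have : (1 : ℝ) < N := by linarith
    exact_mod_cast this
  set A : ℝ → ℂ := fun ξ => freq ξ ^ (β : ℂ) * 𝓕 f ξ with hA
  have hAi : Integrable A := hf.integrable_cpow_mul_fourier hβ.le hβN
  have hAc : Continuous A := by
    refine Continuous.mul (continuous_iff_continuousAt.mpr fun ξ => ?_)
      (continuous_fourier hf.integrable)
    exact ContinuousAt.comp (f := freq) (continuousAt_cpow_freq hβ ξ)
      continuous_freq.continuousAt
  have hinv : 𝓕⁻ A = 0 := by
    rw [← synth_eq]
    ext x
    exact hcon x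
  have hF : 𝓕 A = 0 := by
    ext ξ
    have := congrFun hinv (-ξ)
    rwa [Real.fourierInv_eq_fourier_neg, neg_neg] at this
  have hA0 : A = 0 := by
    have h1 := hAc.fourierInv_fourier_eq hAi (by rw [hF]; exact integrable_zero _ _ _)
    rw [← h1, hF, ← synth_eq]
    ext x
    simp [synth]
  rw [← hf.synth_fourier hN]
  ext x
  rw [synth]
  refine integral_eq_zero_of_ae ?_
  filter_upwards [Measure.ae_ne volume (0 : ℝ)] with ξ hξ
  have h1 := congrFun hA0 ξ
  have h2 : freq ξ ^ (β : ℂ) ≠ 0 := by simp [Complex.cpow_eq_zero_iff, freq_eq_zero, hξ]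
  have h3 : 𝓕 f ξ = 0 := by simpa [hA, h2] using h1
  simp [h3]

/-- Convergence at a single nonzero point forces a positive radius of convergence. Thus a series
known only on the half-plane defines a function analytic in a full disc. -/
theorem exists_analyticAt_hasSum {c : ℕ → ℂ} {z₀ : ℂ} (hz₀ : z₀ ≠ 0)
    (hs : Summable fun j => c j * z₀ ^ j) :
    ∃ H : ℂ → ℂ, AnalyticAt ℂ H 0 ∧ ∀ᶠ z in 𝓝 0, HasSum (fun j => c j * z ^ j) (H z) := by
  set Q : FormalMultilinearSeries ℂ ℂ ℂ := FormalMultilinearSeries.ofScalars ℂ c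
  have hr : (‖z₀‖₊ : ENNReal) ≤ Q.radius := by
    refine Q.le_radius_of_tendsto (l := 0) ?_
    have := hs.tendsto_atTop_zero.norm
    simpa [Q, norm_mul, norm_pow] using this
  have hpos : 0 < Q.radius := lt_of_lt_of_le (by simpa using hz₀) hr
  have hQ := Q.hasFPowerSeriesOnBall hpos
  refine ⟨Q.sum, hQ.analyticAt, ?_⟩
  filter_upwards [Metric.eball_mem_nhds (0 : ℂ) hpos] with z hz
  have := hQ.hasSum hz
  rw [zero_add] at this
  refine this.congr_fun ?_
  intro j
  simp [Q, mul_comm]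

theorem hasLeftDeriv_unique {β : ℝ} {f : ℝ → ℂ} {x : ℝ} {d d' : ℂ} (h : HasLeftDeriv β f x d)
    (h' : HasLeftDeriv β f x d') : d = d' := tendsto_nhds_unique h.2 h'.2

/-! ### The order condition and the expansion coefficients. -/

/-- If the symbol is analytic at `0` and `1 + O(z ^ p)`, it is `1 + z ^ p * H z` with `H`
analytic. -/
theorem exists_remainder_of_isBigO {α : ℝ} {w : ℕ → ℝ} {r : ℝ} {g : ℂ → ℂ} (hg : AnalyticAt ℂ g 0)
    (hsym : ∀ᶠ z in rightHalfNhds, symbolFun α w r z = g z) {p : ℕ} (hp : 1 ≤ p)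
    (hO : (fun z : ℂ => symbolFun α w r z - 1) =O[rightHalfNhds] fun z : ℂ => z ^ p) :
    ∃ H : ℂ → ℂ, AnalyticAt ℂ H 0 ∧ ∀ᶠ z in rightHalfNhds, symbolFun α w r z =
      ∑ l ∈ Finset.range p, (if l = 0 then 1 else 0) * z ^ l + z ^ p * H z := by
  obtain ⟨a, H, hH, hgH⟩ := exists_taylor hg p
  have hH1 : H =O[rightHalfNhds] fun _ => (1 : ℂ) :=
    (hH.continuousAt.tendsto.mono_left nhdsWithin_le_nhds).isBigO_one ℂ
  have hzH : (fun z => z ^ p * H z) =O[rightHalfNhds] fun z : ℂ => z ^ p := by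
    simpa using (Asymptotics.isBigO_refl (fun z : ℂ => z ^ p) rightHalfNhds).mul hH1
  have hone : ∀ z : ℂ, ∑ l ∈ Finset.range p, (if l = 0 then (1 : ℂ) else 0) * z ^ l = 1 := by
    intro z
    rw [Finset.sum_eq_single_of_mem 0 (Finset.mem_range.mpr hp)
      (fun l _ hl => by simp [hl])]
    simp
  have hdiff : (fun z : ℂ => ∑ l ∈ Finset.range p, z ^ l * (a l - if l = 0 then 1 else 0))
      =O[rightHalfNhds] fun z : ℂ => z ^ p := by
    refine (hO.sub hzH).congr' ?_ EventuallyEq.rfl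
    filter_upwards [hsym] with z hz
    simp only [mul_comm (z ^ _), sub_mul, Finset.sum_sub_distrib]
    rw [hone, hz, hgH z]
    ring
  have hreal := hdiff.comp_tendsto tendsto_ofReal_rightHalfNhds
  have hc := eq_zero_of_sum_isBigO (p := p)
    (c := fun l => a l - if l = 0 then 1 else 0) (by
      refine (Asymptotics.isBigO_norm_right.mp ?_)
      refine hreal.trans (Asymptotics.IsBigO.of_bound 1 (Eventually.of_forall fun h => ?_))
      simp)
  refine ⟨H, hH, hsym.mono fun z hz => ?_⟩
  rw [hz, hgH z]
  congr 1
  refine Finset.sum_congr rfl fun l hl => ?_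
  rw [sub_eq_zero.mp (hc l (Finset.mem_range.mp hl))]

theorem uniformBigO_leftOp_sub_fracD {p n : ℕ} (hp : 1 ≤ p) {α : ℝ} (hα : 0 < α) (hαn : α ≤ n)
    {w : ℕ → ℝ} {B : ℝ} (hw : ∀ k, |w k| ≤ B) {r : ℝ} {g : ℂ → ℂ} (hg : AnalyticAt ℂ g 0)
    (hsym : ∀ᶠ z in rightHalfNhds, symbolFun α w r z = g z)
    (hO : (fun z : ℂ => symbolFun α w r z - 1) =O[rightHalfNhds] fun z : ℂ => z ^ p)
    {f : ℝ → ℂ} (hf : SobolevL1 (p + n + 1) f) :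
    UniformBigO (fun h x => leftOp α w r h f x - fracD α f x) p := by
  obtain ⟨H, hH, hs⟩ := exists_remainder_of_isBigO hg hsym hp hO
  obtain ⟨C, h₀, hh₀, hC⟩ := uniformBigO_leftOp_sub_sum hp hα hαn hw hH hs hf
  refine ⟨C, h₀, hh₀, fun h h0 h1 x => ?_⟩
  have := hC h h0 h1 x
  beta_reduce at this
  rw [Finset.sum_eq_single_of_mem 0 (Finset.mem_range.mpr hp)
    (fun l _ hl => by simp [hl])] at this
  simpa using this

/-- Pointwise approximation of order `p` of a nonzero function forces the order condition on the
symbol. -/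
theorem isBigO_of_isBigO_leftOp {p n : ℕ} (hp : 1 ≤ p) {α : ℝ} (hα : 0 < α) (hαn : α ≤ n)
    {w : ℕ → ℝ} {B : ℝ} (hw : ∀ k, |w k| ≤ B) {r : ℝ} {g : ℂ → ℂ} (hg : AnalyticAt ℂ g 0)
    (hsym : ∀ᶠ z in rightHalfNhds, symbolFun α w r z = g z)
    {f : ℝ → ℂ} (hf : SobolevL1 (p + n + 1) f) (hf0 : f ≠ 0)
    (happ : ∀ x, (fun h : ℝ => leftOp α w r h f x - fracD α f x) =O[𝓝[>] 0] fun h : ℝ => h ^ p) :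
    (fun z : ℂ => symbolFun α w r z - 1) =O[rightHalfNhds] fun z : ℂ => z ^ p := by
  obtain ⟨a, H, hH, hgH⟩ := exists_taylor hg p
  have hexp := uniformBigO_leftOp_sub_sum hp hα hαn hw (a := a) hH
    (hsym.mono fun z hz => hz.trans (hgH z)) hf
  have hcoef : ∀ l < p, a l = if l = 0 then 1 else 0 := by
    intro l hl
    have hl' : (l : ℝ) + 1 ≤ p := by exact_mod_cast hl
    -- The point x may depend on l: each coefficient is tested where its own derivative D^(l+α) f is
    -- nonzero.
    obtain ⟨x, hx⟩ := fracD_ne_zero hf hf0 (β := l + α) (by positivity) (by push_cast; linarith)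
    have h1 := (happ x).sub (hexp.isBigO x)
    have h2 := eq_zero_of_sum_isBigO (p := p)
      (c := fun l => (a l - if l = 0 then 1 else 0) * fracD ((l : ℝ) + α) f x)
      (h1.congr_left fun h => by
        have h3 : ∑ l ∈ Finset.range p,
            (h : ℂ) ^ l * ((if l = 0 then 1 else 0) * fracD ((l : ℝ) + α) f x) = fracD α f x := by
          rw [Finset.sum_eq_single_of_mem 0 (Finset.mem_range.mpr hp)
            (fun l _ hl => by simp [hl])]
          simp
        simp only [sub_mul, mul_sub, Finset.sum_sub_distrib]
        rw [h3]
        simp only [mul_assoc]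
        ring)
    have h4 := (mul_eq_zero.mp (h2 l hl)).resolve_right hx
    exact sub_eq_zero.mp h4
  have hH1 : H =O[rightHalfNhds] fun _ => (1 : ℂ) :=
    (hH.continuousAt.tendsto.mono_left nhdsWithin_le_nhds).isBigO_one ℂ
  have hzH : (fun z => z ^ p * H z) =O[rightHalfNhds] fun z : ℂ => z ^ p := by
    simpa using (Asymptotics.isBigO_refl (fun z : ℂ => z ^ p) rightHalfNhds).mul hH1
  refine hzH.congr' ?_ EventuallyEq.rfl
  filter_upwards [hsym] with z hz
  rw [hz, hgH z, Finset.sum_eq_single_of_mem 0 (Finset.mem_range.mpr hp)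
    (fun l hl' hl => by simp [hcoef l (Finset.mem_range.mp hl'), hl]), hcoef 0 hp]
  simp

theorem exists_mem_of_eventually_rightHalfNhds {P : ℂ → Prop}
    (h : ∀ᶠ z in rightHalfNhds, P z) : ∃ z, z ≠ 0 ∧ P z := by
  have h1 := tendsto_ofReal_rightHalfNhds.eventually h
  obtain ⟨t, ht, ht0⟩ := (h1.and self_mem_nhdsWithin).exists
  have ht0 : 0 < t := ht0
  exact ⟨t, by exact_mod_cast ht0.ne', ht⟩

/-- Error expansion with the coefficients of the Taylor series of the symbol. -/
theorem uniformBigO_leftOp_sub_expansion {p m n : ℕ} (hp : 1 ≤ p) (hpm : p ≤ m) {α : ℝ}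
    (hα : 0 < α) (hαn : α ≤ n) {w : ℕ → ℝ} {B : ℝ} (hw : ∀ k, |w k| ≤ B) {r : ℝ} {a : ℕ → ℂ}
    (ha : ∀ᶠ z in rightHalfNhds,
      HasSum (fun j : ℕ => a (p + j) * z ^ (p + j)) (symbolFun α w r z - 1))
    {f : ℝ → ℂ} (hf : SobolevL1 (m + n + 1) f) :
    UniformBigO (fun h x => leftOp α w r h f x - (fracD (((0 : ℕ) : ℝ) + α) f x +
      ∑ l ∈ Finset.Ico p m, (h : ℂ) ^ l * a l * fracD ((l : ℝ) + α) f x)) m := by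
  -- Padding with 1, 0, …, 0 below index p makes b the full Taylor sequence of G_r, whatever values
  -- a takes there.
  set b : ℕ → ℂ := fun l => if l = 0 then 1 else if l < p then 0 else a l with hb
  have hb0 : ∀ c : ℕ → ℂ, ∑ l ∈ Finset.range p, b l * c l = c 0 := fun c => by
    rw [Finset.sum_eq_single_of_mem 0 (Finset.mem_range.mpr hp)
      (fun l hl' hl => by simp [hb, hl, Finset.mem_range.mp hl'])]
    simp [hb]
  have hbp : ∀ l, p ≤ l → b l = a l := fun l hl => by
    simp [hb, show l ≠ 0 by omega, not_lt.mpr hl]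
  have hsum : ∀ᶠ z in rightHalfNhds, HasSum (fun j : ℕ => b (j + m) * z ^ (j + m))
      (symbolFun α w r z - ∑ l ∈ Finset.range m, b l * z ^ l) := by
    filter_upwards [ha] with z hz
    have h1 : HasSum (fun j : ℕ => b (j + p) * z ^ (j + p)) (symbolFun α w r z - 1) := by
      refine hz.congr_fun fun j => ?_
      rw [add_comm j p, hbp _ (Nat.le_add_right p j)]
    have h2 := (hasSum_nat_add_iff (f := fun l => b l * z ^ l) p).mp h1
    rw [hb0 (fun l => z ^ l), pow_zero, sub_add_cancel] at h2
    exact (hasSum_nat_add_iff' (f := fun l => b l * z ^ l) m).mpr h2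
  obtain ⟨z₀, hz₀, hs₀⟩ := exists_mem_of_eventually_rightHalfNhds hsum
  have hsm : Summable fun j => b (j + m) * z₀ ^ j := by
    refine (hs₀.summable.mul_right (z₀ ^ m)⁻¹).congr fun j => ?_
    rw [pow_add]
    field_simp
  obtain ⟨H, hH, hHs⟩ := exists_analyticAt_hasSum hz₀ hsm
  have hsym : ∀ᶠ z in rightHalfNhds,
      symbolFun α w r z = ∑ l ∈ Finset.range m, b l * z ^ l + z ^ m * H z := by
    filter_upwards [hsum, nhdsWithin_le_nhds hHs] with z h1 h2
    have h3 : HasSum (fun j : ℕ => b (j + m) * z ^ (j + m)) (z ^ m * H z) :=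
      (h2.mul_left (z ^ m)).congr_fun fun j => by ring
    rw [← h1.unique h3]
    ring
  obtain ⟨C, h₀, hh₀, hC⟩ := uniformBigO_leftOp_sub_sum (hp.trans hpm) hα hαn hw hH hsym hf
  refine ⟨C, h₀, hh₀, fun h h0 h1 x => ?_⟩
  have h2 := hC h h0 h1 x
  beta_reduce at h2
  rw [← Finset.sum_range_add_sum_Ico _ hpm, Finset.sum_congr rfl fun l _ => by
      rw [mul_right_comm, mul_comm], hb0 fun l => (h : ℂ) ^ l * fracD ((l : ℝ) + α) f x,
    pow_zero, one_mul, Finset.sum_congr rfl fun l hl => by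
      rw [hbp l (Finset.mem_Ico.mp hl).1]] at h2
  exact h2

end Grunwald

end

/-! ### Assembly of the theorem. -/

theorem mainTheorem1 (n m : ℕ) (hn : 1 ≤ n) (α : ℝ) (hα₁ : (n : ℝ) - 1 < α) (hα₂ : α ≤ n)
    (r : ℝ) (w : ℕ → ℝ) (hw : ∃ C : ℝ, ∀ k : ℕ, |w k| ≤ C)
    (hG : ∃ g : ℂ → ℂ, AnalyticAt ℂ g 0 ∧
      ∀ᶠ z in Grunwald.rightHalfNhds, Grunwald.symbolFun α w r z = g z)
    (f : ℝ → ℂ) (hf : ContDiff ℝ ((m + n + 1 : ℕ) : WithTop ℕ∞) f)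
    (hint : ∀ k : ℕ, k ≤ m + n + 1 → Integrable (iteratedDeriv k f) volume)
    (p : ℕ) (hp : 1 ≤ p) (hpm : p ≤ m) :
    -- the equivalence
    (f ≠ 0 →
      (Grunwald.ApproximatesWithOrder α w r p f ↔
        (fun z : ℂ => Grunwald.symbolFun α w r z - 1)
          =O[Grunwald.rightHalfNhds] fun z : ℂ => z ^ p)) ∧
    -- in the direction from right to left the order is uniform in `x`, and `f = 0` is allowed
    ((fun z : ℂ => Grunwald.symbolFun α w r z - 1)
        =O[Grunwald.rightHalfNhds] (fun z : ℂ => z ^ p) →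
      Grunwald.ApproximatesWithOrderUniformly α w r p f) ∧
    -- the error expansions
    (∀ a : ℕ → ℂ,
      (∀ᶠ z in Grunwald.rightHalfNhds,
        HasSum (fun j : ℕ => a (p + j) * z ^ (p + j)) (Grunwald.symbolFun α w r z - 1)) →
      (∃ D : ℕ → ℝ → ℂ,
        (∀ l : ℕ, l < m → ∀ x : ℝ, Grunwald.HasLeftDeriv ((l : ℝ) + α) f x (D l x)) ∧
        Grunwald.UniformBigO
          (fun h x => Grunwald.leftOp α w r h f x -
            (D 0 x + ∑ l ∈ Finset.Ico p m, (h : ℂ) ^ l * a l * D l x)) m) ∧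
      (∃ D : ℕ → ℝ → ℂ,
        (∀ l : ℕ, l < m → ∀ x : ℝ, Grunwald.HasRightDeriv ((l : ℝ) + α) f x (D l x)) ∧
        Grunwald.UniformBigO
          (fun h x => Grunwald.rightOp α w r h f x -
            (D 0 x + ∑ l ∈ Finset.Ico p m, (h : ℂ) ^ l * a l * D l x)) m)) := by
  obtain ⟨B, hB⟩ := hw
  obtain ⟨g, hg, hsym⟩ := hG
  have hα : 0 < α := by
    have : (1 : ℝ) ≤ n := by exact_mod_cast hn
    linarith
  have hL : Grunwald.SobolevL1 (m + n + 1) f := ⟨hf, hint⟩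
  have hR := hL.comp_neg
  have hderiv : ∀ φ : ℝ → ℂ, Grunwald.SobolevL1 (m + n + 1) φ → ∀ l : ℕ, l < m → ∀ x,
      Grunwald.HasLeftDeriv ((l : ℝ) + α) φ x (Grunwald.fracD ((l : ℝ) + α) φ x) := by
    intro φ hφ l hl x
    have hl' : (l : ℝ) + 1 ≤ m := by exact_mod_cast hl
    -- Since l ≤ m - 1, the order l + α is at most m + n - 1, and existence needs exactly two
    -- derivatives more, that is m + n + 1.
    exact Grunwald.hasLeftDeriv_fracD (n := m + n - 1) (by positivity)
      (by rw [Nat.cast_sub (by omega)]; push_cast; linarith)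
      (by rwa [show m + n - 1 + 2 = m + n + 1 by omega]) x
  have hderiv0 : ∀ φ : ℝ → ℂ, Grunwald.SobolevL1 (m + n + 1) φ → ∀ x,
      Grunwald.HasLeftDeriv α φ x (Grunwald.fracD α φ x) := by
    intro φ hφ x
    simpa using hderiv φ hφ 0 (by omega) x
  have hconv : ∀ φ : ℝ → ℂ, Grunwald.SobolevL1 (m + n + 1) φ → ∀ x,
      Grunwald.LeftConverges w r φ x := fun φ hφ x =>
    Grunwald.leftConverges_of_bounded hB (by omega) hφ r x
  have hunif : (fun z : ℂ => Grunwald.symbolFun α w r z - 1)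
      =O[Grunwald.rightHalfNhds] (fun z : ℂ => z ^ p) →
      Grunwald.ApproximatesWithOrderUniformly α w r p f := by
    intro hO
    refine ⟨fun x => ⟨hconv f hL x, (Grunwald.rightConverges_iff w r f x).mpr (hconv _ hR _)⟩,
      ⟨Grunwald.fracD α f, hderiv0 f hL, ?_⟩,
      ⟨fun x => Grunwald.fracD α (fun y => f (-y)) (-x),
        fun x => (Grunwald.hasRightDeriv_iff α f x _).mpr (hderiv0 _ hR _), ?_⟩⟩
    · exact Grunwald.uniformBigO_leftOp_sub_fracD hp hα hα₂ hB hg hsym hO (hL.mono (by omega))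
    · simp only [Grunwald.rightOp_eq_leftOp]
      exact (Grunwald.uniformBigO_leftOp_sub_fracD hp hα hα₂ hB hg hsym hO
        (hR.mono (by omega))).comp fun x => -x
  refine ⟨fun hf0 => ⟨fun happ => ?_, fun hO x => ?_⟩, hunif, fun a ha => ⟨?_, ?_⟩⟩
  · refine Grunwald.isBigO_of_isBigO_leftOp hp hα hα₂ hB hg hsym
      (hL.mono (by omega : p + n + 1 ≤ m + n + 1)) hf0 fun x => ?_
    obtain ⟨⟨-, d, hd, hO⟩, -⟩ := happ x
    -- Uniqueness of limits identifies the derivative supplied by the hypothesis with the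
    -- multiplier; the left-sided half alone forces the condition on G_r.
    rwa [Grunwald.hasLeftDeriv_unique hd (hderiv0 f hL x)] at hO
  · obtain ⟨hc, ⟨D, hD, hDO⟩, ⟨E, hE, hEO⟩⟩ := hunif hO
    exact ⟨⟨(hc x).1, D x, hD x, hDO.isBigO x⟩, ⟨(hc x).2, E x, hE x, hEO.isBigO x⟩⟩
  · exact ⟨fun l x => Grunwald.fracD ((l : ℝ) + α) f x, hderiv f hL,
      Grunwald.uniformBigO_leftOp_sub_expansion hp hpm hα hα₂ hB ha hL⟩
  · refine ⟨fun l x => Grunwald.fracD ((l : ℝ) + α) (fun y => f (-y)) (-x),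
      fun l hl x => (Grunwald.hasRightDeriv_iff _ f x _).mpr (hderiv _ hR l hl _), ?_⟩
    simp only [Grunwald.rightOp_eq_leftOp]
    exact (Grunwald.uniformBigO_leftOp_sub_expansion hp hpm hα hα₂ hB ha hR).comp fun x => -x
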